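/- **Theorem (global trace inequality for immersed finite element functions).** Let $\Omega\subset\mathbb{R}^2$ be a domain (open, connected), let $T>0$, let $\beta^\pm>0$ be constants, and let $\Gamma(t)$, $t\in[0,T]$, be a moving interface in $\Omega$: $\Gamma(t)=\gamma(t,\mathbb{R})$, where $\gamma$ is $C^1$ on $[0,T]\times\mathbb{R}$ with values in $\Omega$, each $\gamma(t,\cdot)$ is $1$-periodic, injective on $[0,1)$ and has non-vanishing derivative, and $\partial_t\gamma(t,s)=\mathcal V(\gamma(t,s),t)$ for a velocity field $\mathcal V$. For each $t$ the curve divides $\Omega$ into two subdomains: $\Omega\setminus\Gamma(t)=\Omega^-(t)\cup\Omega^+(t)$ with $\Omega^\pm(t)$ open, connected and disjoint. Let $\sigma,q$ be real numbers. We consider finite conforming triangulations $\mathcal T_h$ of $\Omega$ (the closed triangles cover $\overline\Omega$, their interiors lie in $\Omega$, and any two of them intersect in the convex hull of their common vertices) that are shape regular with constant $\sigma$ (each $K\in\mathcal T_h$ contains a disc of diameter $\rho_K>0$ with $\operatorname{diam}K\le\sigma\rho_K$) and quasi-uniform with constant $q$ ($\operatorname{diam}L\le q\operatorname{diam}K$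 for all $K,L\in\mathcal T_h$). An element $K$ is an interface element at time $t$ if $\Gamma(t)$ meets its interior. The mesh resolves $\Gamma(t)$ if $\Gamma(t)$ meets the boundary of each interface element in exactly two points, located on different edges (no edge contains both), and meets every other element at most in vertices. For an interface element $K$ with intersection points $D,E$, the segment $DE$ divides $K$ into closed pieces $K^-$ and $K^+$, labelled so that every vertex of $K$ in $\Omega^\pm(t)$ lies in $K^\pm$. The local space $S_{h,K}(t)$ consists of the functions $w$ on $K$ for which there are affine functions $p^\pm$ with $w=p^\pm$ on $K^\pm$, $p^-=p^+$ on $DE$ and $\beta^-\nabla p^-\cdot\bar{\mathbf n}=\beta^+\nabla p^+\cdot\bar{\mathbf n}$, where $\bar{\mathbf n}$ is a normal to $DE$. On every other element $S_{h,K}(t)$ is the space of affine functions. The non-conforming space $S_h(t)$ consists of the functions $v_h$ that coincide in the interior of each $K$ with some $w_K\in S_{h,K}(t)$, such that the $w_K$ agree at common nodes and vanish on $\partial\Omega$. Then there is a constant $C>0$, depending only on $\Omega$, the moving interface $(\Gamma(t))_{t\in[0,T]}$, $\beta^\pm$, $\sigma$ and $q$ (and hence independent of the mesh, the mesh size, the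 time $t$ and the position of the interface relative to the mesh), such that for every such triangulation $\mathcal T_h$, every $t\in[0,T]$ at which $\mathcal T_h$ resolves $\Gamma(t)$, and every $v_h\in S_h(t)$, $$\|v_h\|_{L^2(\Gamma(t))}\le C\,\|v_h\|_{H^1(\Omega)},\qquad \|v_h\|_{H^1(\Omega)}^2:=\sum_{K\in\mathcal T_h}\left(\|v_h\|_{L^2(K)}^2+\|\nabla v_h\|_{L^2(K)}^2\right),$$ where $L^2(\Gamma(t))$ is taken with respect to arc length and $\nabla v_h$ is the weak gradient inside each element. -/

import Mathlib

open MeasureTheory Set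
open scoped ENNReal

noncomputable section

namespace IFE

/-- The plane with its Euclidean norm. -/
abbrev Plane : Type := EuclideanSpace ℝ (Fin 2)

/-! ### Triangulations -/

/-- The closed triangle (convex hull) spanned by a finite set of vertices. -/
def hull (K : Finset Plane) : Set Plane := convexHull ℝ (K : Set Plane)

/-- A conforming triangular partition of `Ω`; a triangle is recorded by its set of three
vertices. The nodes are the vertices of the triangles, the edges of a triangle `K` are the
segments `segment ℝ A B` with `A, B ∈ K`. -/
structure Triangulation (Ω : Set Plane) where
  cells : Finset (Finset Plane)
  card_eq : ∀ K ∈ cells, K.card = 3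
  indep : ∀ K ∈ cells, AffineIndependent ℝ (fun A : K => (A : Plane))
  conforming : ∀ K ∈ cells, ∀ L ∈ cells,
    hull K ∩ hull L = convexHull ℝ ((K : Set Plane) ∩ (L : Set Plane))
  cover : (⋃ K ∈ cells, hull K) = closure Ω
  interior_subset : ∀ K ∈ cells, interior (hull K) ⊆ Ω

/-- Shape regularity with constant `σ`: every triangle `K` contains a disc of diameter `2 * r`
with `diam K ≤ σ * (2 * r)`. -/
def Triangulation.ShapeRegular {Ω : Set Plane} (𝓣 : Triangulation Ω) (σ : ℝ) : Prop :=
  ∀ K ∈ 𝓣.cells, ∃ (c : Plane) (r : ℝ), 0 < r ∧ Metric.closedBall c r ⊆ hull K ∧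
    Metric.diam (hull K) ≤ σ * (2 * r)

/-- Quasi-uniformity with constant `q`: the mesh size is at most `q` times the diameter of each
triangle. -/
def Triangulation.QuasiUniform {Ω : Set Plane} (𝓣 : Triangulation Ω) (q : ℝ) : Prop :=
  ∀ K ∈ 𝓣.cells, ∀ L ∈ 𝓣.cells, Metric.diam (hull L) ≤ q * Metric.diam (hull K)

/-! ### The evolving interface -/

/-- A moving interface in `Ω` over the time interval `[0, T]`: at each time a regular simple closed
curve `γ t` (parametrized with period `1`) that lies in `Ω` and hence does not touch the boundary;
its points move with a velocity field, and it splits `Ω` into two subdomains. -/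
structure MovingInterface (Ω : Set Plane) (T : ℝ) where
  γ : ℝ → ℝ → Plane
  velocity : ℝ → Plane → Plane
  Ωminus : ℝ → Set Plane
  Ωplus : ℝ → Set Plane
  smooth : ContDiffOn ℝ 1 (fun p : ℝ × ℝ => γ p.1 p.2) (Icc 0 T ×ˢ univ)
  periodic : ∀ t ∈ Icc 0 T, Function.Periodic (γ t) 1
  regular : ∀ t ∈ Icc 0 T, ∀ s, deriv (γ t) s ≠ 0
  simple : ∀ t ∈ Icc 0 T, InjOn (γ t) (Ico 0 1)
  mem_domain : ∀ t ∈ Icc 0 T, ∀ s, γ t s ∈ Ω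
  motion : ∀ t ∈ Icc 0 T, ∀ s,
    HasDerivWithinAt (fun τ => γ τ s) (velocity t (γ t s)) (Icc 0 T) t
  isOpen_minus : ∀ t ∈ Icc 0 T, IsOpen (Ωminus t)
  isOpen_plus : ∀ t ∈ Icc 0 T, IsOpen (Ωplus t)
  isConnected_minus : ∀ t ∈ Icc 0 T, IsConnected (Ωminus t)
  isConnected_plus : ∀ t ∈ Icc 0 T, IsConnected (Ωplus t)
  disjoint : ∀ t ∈ Icc 0 T, Disjoint (Ωminus t) (Ωplus t)
  partition : ∀ t ∈ Icc 0 T, Ωminus t ∪ Ωplus t = Ω \ range (γ t)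

/-- The curve `Γ(t)` as a set of points. -/
def MovingInterface.curve {Ω : Set Plane} {T : ℝ} (Γ : MovingInterface Ω T) (t : ℝ) :
    Set Plane :=
  range (Γ.γ t)

/-- `G` meets the boundary of the triangle `K` in exactly the two points `D` and `E`, which lie on
different edges (no edge contains both). -/
def CutsAt (G : Set Plane) (K : Finset Plane) (D E : Plane) : Prop :=
  D ≠ E ∧ G ∩ frontier (hull K) = {D, E} ∧
    ∀ A ∈ K, ∀ B ∈ K, ¬ (D ∈ segment ℝ A B ∧ E ∈ segment ℝ A B)

/-- `K` is an interface element for the curve `G`: the curve passes through its interior. -/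
def IsInterfaceElement (G : Set Plane) (K : Finset Plane) : Prop :=
  (G ∩ interior (hull K)).Nonempty

/-- The mesh resolves the curve `G`: `G` meets the boundary of each interface element in exactly two
points, located on different edges; any other element is met by `G` at most in vertices. -/
def Triangulation.Resolves {Ω : Set Plane} (𝓣 : Triangulation Ω) (G : Set Plane) : Prop :=
  ∀ K ∈ 𝓣.cells,
    (IsInterfaceElement G K → ∃ D E, CutsAt G K D E) ∧
    (¬ IsInterfaceElement G K → G ∩ hull K ⊆ (K : Set Plane))

/-! ### Immersed finite element spaces -/

/-- `w` is a local immersed finite element function on the interface element `K`. The segment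
`D E` joining the two intersection points has normal `n`, pointing from `K⁻` to `K⁺`, where
`K⁻ = {x ∈ K | ⟪n, x - D⟫ ≤ 0}` and `K⁺ = {x ∈ K | 0 ≤ ⟪n, x - D⟫}` are the two pieces of `K`,
labelled by the subdomains in which the vertices of `K` lie. -/
def IsLocalIFECut (G Ωm Ωp : Set Plane) (βm βp : ℝ) (K : Finset Plane) (w : Plane → ℝ) : Prop :=
  ∃ (D E n : Plane) (pm pp : Plane →ᵃ[ℝ] ℝ),
    CutsAt G K D E ∧
    n ≠ 0 ∧ inner ℝ n (E - D) = 0 ∧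
    (∀ A ∈ K, A ∈ Ωm → inner ℝ n (A - D) ≤ 0) ∧
    (∀ A ∈ K, A ∈ Ωp → 0 ≤ inner ℝ n (A - D)) ∧
    (∀ x ∈ hull K, inner ℝ n (x - D) ≤ 0 → w x = pm x) ∧
    (∀ x ∈ hull K, 0 ≤ inner ℝ n (x - D) → w x = pp x) ∧
    (∀ x ∈ segment ℝ D E, pm x = pp x) ∧
    βm * pm.linear n = βp * pp.linear n

/-- The local space on `K`: immersed finite element functions on an interface element, affine
functions on any other element. -/
def IsLocalIFE (G Ωm Ωp : Set Plane) (βm βp : ℝ) (K : Finset Plane) (w : Plane → ℝ) : Prop :=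
  (IsInterfaceElement G K → IsLocalIFECut G Ωm Ωp βm βp K w) ∧
  (¬ IsInterfaceElement G K → ∃ p : Plane →ᵃ[ℝ] ℝ, ∀ x ∈ hull K, w x = p x)

/-- The global space `S_h(t)`: functions `v` that coincide inside each triangle `K` with a local
function `w K`, such that the local functions agree at common nodes and vanish on `∂Ω`. The values
of `v` on the (Lebesgue null) union of the edges are immaterial, as for elements of `L²(Ω)`. -/
def ifeSpace {Ω : Set Plane} {T : ℝ} (𝓣 : Triangulation Ω) (Γ : MovingInterface Ω T)
    (βm βp : ℝ) (t : ℝ) : Set (Plane → ℝ) :=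
  {v | ∃ w : Finset Plane → Plane → ℝ,
    (∀ K ∈ 𝓣.cells, IsLocalIFE (Γ.curve t) (Γ.Ωminus t) (Γ.Ωplus t) βm βp K (w K)) ∧
    (∀ K ∈ 𝓣.cells, ∀ x ∈ interior (hull K), v x = w K x) ∧
    (∀ K ∈ 𝓣.cells, ∀ L ∈ 𝓣.cells, ∀ X, X ∈ K → X ∈ L → w K X = w L X) ∧
    (∀ K ∈ 𝓣.cells, ∀ x ∈ hull K ∩ frontier Ω, w K x = 0)}

/-! ### Norms -/

/-- `g` is a weak gradient of `v` in the open set `U`. -/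
def IsWeakGradient (U : Set Plane) (v : Plane → ℝ) (g : Plane → Plane) : Prop :=
  LocallyIntegrableOn v U ∧ LocallyIntegrableOn g U ∧
    ∀ φ : Plane → ℝ, ContDiff ℝ (⊤ : ℕ∞) φ → HasCompactSupport φ → tsupport φ ⊆ U →
      ∀ e : Plane, ∫ x in U, v x * fderiv ℝ φ x e = - ∫ x in U, inner ℝ (g x) e * φ x

/-- `‖v‖²` in `L²(U)`, as an extended real. -/
def l2Sq (U : Set Plane) (v : Plane → ℝ) : ℝ≥0∞ := ∫⁻ x in U, ‖v x‖ₑ ^ 2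

/-- `|v|²` in `H¹(U)`, the squared `L²(U)` norm of the weak gradient (which is unique almost
everywhere), as an extended real; it is `∞` if there is no weak gradient. -/
def h1SemiSq (U : Set Plane) (v : Plane → ℝ) : ℝ≥0∞ :=
  ⨅ (g : Plane → Plane) (_ : IsWeakGradient U v g), ∫⁻ x in U, ‖g x‖ₑ ^ 2

/-- The (broken) `H¹(Ω)` norm with respect to the mesh, the square root of
`∑_K (‖v‖² in L²(K) + |v|² in H¹(K))`. -/
def brokenH1Norm {Ω : Set Plane} (𝓣 : Triangulation Ω) (v : Plane → ℝ) : ℝ≥0∞ :=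
  (∑ K ∈ 𝓣.cells, (l2Sq (interior (hull K)) v + h1SemiSq (interior (hull K)) v)) ^ (1 / 2 : ℝ)

/-- The norm of `L²(Γ(t))` with respect to arc length. -/
def interfaceL2Norm {Ω : Set Plane} {T : ℝ} (Γ : MovingInterface Ω T) (t : ℝ)
    (v : Plane → ℝ) : ℝ≥0∞ :=
  (∫⁻ s in Ico (0 : ℝ) 1, ‖v (Γ.γ t s)‖ₑ ^ 2 * ‖deriv (Γ.γ t) s‖ₑ) ^ (1 / 2 : ℝ)

end IFE

end

namespace IFE

/-! ### Piecewise Lipschitz functions on an interval -/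

/-! A function in the space may jump across edges, so it has no trace inequality of its own. It is
compared with its nodal interpolant `d K + ⟪b K, x⟫`, which is continuous because the nodal values
are shared and the mesh is conforming.

The error is local. On an interface element the two gradients differ by a multiple of the normal,
and flux continuity makes their sizes comparable with a constant `κ` depending only on the ratio of
the coefficients. Hence `M`, the larger size, satisfies `M² |K| ≤ κ² |v|²` in `H¹(K)` however small
one of the cut pieces is (`IsBrokenAffineOn.mul_volume_le_h1SemiSq`). The function is `M`-Lipschitz,
so the error is at most `2 M diam K`, and shape regularity gives `diam² ≲ |K|`. In dimension two the
mesh size cancels: the squared sup error on `K` is bounded by the seminorm on `K` alone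
(`IsBrokenAffineOn.interpolation_estimates`). The length of the curve is bounded, so these errors
may simply be summed.

The interpolant obeys the classical trace inequality. From each point of the curve an axis-parallel
segment of fixed length `δ` stays in `Ω`, and the value at its start is controlled by the values and
gradients along it (`ofReal_mul_sq_le_lintegral_traceDensity`). By compactness of the space-time
curve, finitely many pieces, with bounds uniform in time, are graphs over an axis; moving
transversally to that axis sweeps out area (`lintegral_curve_strip_le`, `lintegral_curve_le`). -/

theorem add_sq_le_of_sq_le {x y p q X S : ℝ} (hp : 0 ≤ p) (hq : 0 ≤ q) (hX : 0 ≤ X) (hS : 0 ≤ S)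
    (hx : x ^ 2 ≤ p * X) (hy : y ^ 2 ≤ q * S) : (x + y) ^ 2 ≤ (p + q) * (X + S) := by
  have h1 : (x * y) ^ 2 ≤ (p * S) * (q * X) := by
    calc (x * y) ^ 2 = x ^ 2 * y ^ 2 := by ring
      _ ≤ (p * X) * (q * S) := by gcongr
      _ = _ := by ring
  have h2 : 2 * (x * y) ≤ p * S + q * X := by
    apply le_of_abs_le
    apply abs_le_of_sq_le_sq _ (by positivity)
    nlinarith [sq_nonneg (p * S - q * X)]
  nlinarith

/-- A function on an interval that is covered by finitely many closed intervals, on each of which it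
is Lipschitz, satisfies the Cauchy-Schwarz estimate for its increment. -/
theorem sq_sub_le_of_cover {ι : Type*} [DecidableEq ι] (f : ℝ → ℝ) (A : ι → Set ℝ) (c : ι → ℝ)
    (b : ℝ) (n : ℕ) : ∀ F : Finset ι, F.card = n →
    (∀ i ∈ F, IsClosed (A i)) → (∀ i ∈ F, (A i).OrdConnected) →
    (∀ i ∈ F, ∀ x ∈ A i, ∀ y ∈ A i, |f x - f y| ≤ c i * |x - y|) →
    ∀ a : ℝ, a ≤ b → Icc a b ⊆ ⋃ i ∈ F, A i →
      (f b - f a) ^ 2 ≤ (b - a) * ∑ i ∈ F, c i ^ 2 * volume.real (A i ∩ Icc a b) := by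
  induction n with
  | zero =>
    intro F hF _ _ _ a hab h
    obtain rfl := Finset.card_eq_zero.1 hF
    simpa using h (left_mem_Icc.2 hab)
  | succ n ih =>
    intro F hF hcl hoc hf a hab h
    obtain ⟨i, hi, hai⟩ : ∃ i ∈ F, a ∈ A i := by simpa using h (left_mem_Icc.2 hab)
    have hcpt : IsCompact (A i ∩ Icc a b) := isCompact_Icc.inter_left (hcl i hi)
    have hne : (A i ∩ Icc a b).Nonempty := ⟨a, hai, left_mem_Icc.2 hab⟩
    -- `A i` contains `a` and is followed to its last point `m`. It does not meet `(m, b]`, so it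
    -- can be discarded and the induction applied on `[m, b]`.
    obtain ⟨m, ⟨hmA, ham, hmb⟩, hmax⟩ := hcpt.exists_isGreatest hne
    have hfin : ∀ j x, volume (A j ∩ Icc x b) ≠ ∞ := fun j x =>
      ((measure_mono inter_subset_right).trans_lt measure_Icc_lt_top).ne
    have hmeas : m - a ≤ volume.real (A i ∩ Icc a b) := by
      rw [← Real.volume_real_Icc_of_le ham]
      exact measureReal_mono
        (fun x hx => ⟨(hoc i hi).out hai hmA hx, hx.1, hx.2.trans hmb⟩) (hfin i a)
    have hx : (f m - f a) ^ 2 ≤ (m - a) * (c i ^ 2 * (m - a)) := by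
      have := hf i hi m hmA a hai
      rw [abs_of_nonneg (sub_nonneg.2 ham)] at this
      calc (f m - f a) ^ 2 = |f m - f a| ^ 2 := (sq_abs _).symm
        _ ≤ (c i * (m - a)) ^ 2 := by gcongr
        _ = _ := by ring
    have hy : (f b - f m) ^ 2 ≤
        (b - m) * ∑ j ∈ F.erase i, c j ^ 2 * volume.real (A j ∩ Icc a b) := by
      rcases hmb.eq_or_lt with rfl | hlt
      · simp
      refine (ih (F.erase i) (by rw [Finset.card_erase_of_mem hi, hF]; rfl)
        (fun j hj => hcl j (Finset.mem_of_mem_erase hj))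
        (fun j hj => hoc j (Finset.mem_of_mem_erase hj))
        (fun j hj => hf j (Finset.mem_of_mem_erase hj)) m hmb ?_).trans ?_
      · have hclosed : IsClosed (⋃ j ∈ F.erase i, A j) :=
          isClosed_biUnion_finset fun j hj => hcl j (Finset.mem_of_mem_erase hj)
        -- The remaining sets visibly cover only `(m, b]`; their finite union is closed, which
        -- recovers `m`.
        rw [← closure_Ioc hlt.ne]
        refine closure_minimal (fun x hx => ?_) hclosed
        obtain ⟨j, hj, hxj⟩ : ∃ j ∈ F, x ∈ A j := by
          simpa using h ⟨ham.trans hx.1.le, hx.2⟩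
        refine mem_biUnion (x := j) (Finset.mem_coe.2 (Finset.mem_erase.2 ⟨?_, hj⟩)) hxj
        intro hji
        exact absurd (hmax ⟨hji ▸ hxj, ham.trans hx.1.le, hx.2⟩) (not_le.2 hx.1)
      · gcongr with j hj
        · exact hfin j a
    calc (f b - f a) ^ 2 = ((f m - f a) + (f b - f m)) ^ 2 := by ring
      _ ≤ ((m - a) + (b - m)) * (c i ^ 2 * (m - a) +
            ∑ j ∈ F.erase i, c j ^ 2 * volume.real (A j ∩ Icc a b)) :=
          add_sq_le_of_sq_le (sub_nonneg.2 ham) (sub_nonneg.2 hmb)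
            (mul_nonneg (sq_nonneg _) (sub_nonneg.2 ham)) (by positivity) hx hy
      _ ≤ (b - a) * (c i ^ 2 * volume.real (A i ∩ Icc a b) +
            ∑ j ∈ F.erase i, c j ^ 2 * volume.real (A j ∩ Icc a b)) := by
          rw [sub_add_sub_cancel']
          gcongr
      _ = _ := by
          rw [Finset.add_sum_erase F (fun j => c j ^ 2 * volume.real (A j ∩ Icc a b)) hi]

/-! ### The strip swept by translating a curve -/

theorem lintegral_lintegral_single {i j : Fin 2} (hij : i ≠ j) {Q : Plane → ℝ≥0∞}
    (hQ : Measurable Q) :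
    ∫⁻ x : ℝ, ∫⁻ r : ℝ, Q (EuclideanSpace.single i x + EuclideanSpace.single j r) = ∫⁻ z, Q z := by
  have key : ∫⁻ x : ℝ, ∫⁻ r : ℝ, Q (EuclideanSpace.single 0 x + EuclideanSpace.single 1 r)
      = ∫⁻ z, Q z := by
    have h1 := (EuclideanSpace.volume_preserving_symm_measurableEquiv_toLp (Fin 2)).symm
    have h2 := (volume_preserving_finTwoArrow ℝ).symm
    have h3 := h1.comp h2
    rw [← h3.lintegral_comp hQ, Measure.volume_eq_prod,
      lintegral_prod (fun z => Q (_ : Plane)) (hQ.comp h3.measurable).aemeasurable]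
    refine lintegral_congr fun x => lintegral_congr fun r => ?_
    congr 1
    ext k
    fin_cases k <;> simp
  have hm : Measurable (Function.uncurry fun x r : ℝ =>
      Q (EuclideanSpace.single 1 x + EuclideanSpace.single 0 r)) := by
    have h : ∀ (k : Fin 2) (x : ℝ), (EuclideanSpace.single k x : Plane)
        = x • EuclideanSpace.single k 1 := by
      intro k x
      ext l
      simp
    refine hQ.comp (g := Q) (f := fun p : ℝ × ℝ =>
      (EuclideanSpace.single 1 p.1 + EuclideanSpace.single 0 p.2 : Plane)) ?_
    have h' : (fun p : ℝ × ℝ => (EuclideanSpace.single 1 p.1 + EuclideanSpace.single 0 p.2 : Plane))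
        = fun p => p.1 • EuclideanSpace.single 1 1 + p.2 • EuclideanSpace.single 0 1 :=
      funext fun p => by rw [h 1 p.1, h 0 p.2]
    rw [h']
    fun_prop
  fin_cases i <;> fin_cases j
  · simp at hij
  · exact key
  · rw [← key]
    exact (lintegral_lintegral_swap hm.aemeasurable).trans (by simp [add_comm])
  · simp at hij

/-- Coordinate `i` is injective along the arc by Rolle, so it can serve as a new variable at the
price of `|η' s i| ≥ c`. Translation invariance of the inner integral absorbs coordinate `j`, and
Tonelli gives the plane integral. -/
theorem lintegral_curve_strip_le {i j : Fin 2} (hij : i ≠ j) {Q : Plane → ℝ≥0∞}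
    (hQ : Measurable Q) {η η' : ℝ → Plane} (hη : ∀ s, HasDerivAt η (η' s) s) {a b c : ℝ}
    (hc : 0 < c) (hη' : ∀ s ∈ Icc a b, c ≤ |η' s i|) :
    ∫⁻ s in Ico a b, ∫⁻ r : ℝ, Q (η s + EuclideanSpace.single j r) ≤
      ENNReal.ofReal c⁻¹ * ∫⁻ z, Q z := by
  have hd : ∀ k, ∀ s, HasDerivAt (fun s => η s k) (η' s k) s := fun k s =>
    (hasDerivAt_pi.1 ((PiLp.hasFDerivAt_ofLp 2 (η s)).comp_hasDerivAt s (hη s))) k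
  have hinj : InjOn (fun s => η s i) (Ico a b) := by
    have aux : ∀ x ∈ Ico a b, ∀ y ∈ Ico a b, x < y → η x i ≠ η y i := by
      intro x hx y hy hxy h
      obtain ⟨z, hz, hz'⟩ := exists_deriv_eq_zero hxy
        (HasDerivAt.continuousOn fun s _ => hd i s) h
      rw [(hd i z).deriv] at hz'
      have := hη' z ⟨hx.1.trans hz.1.le, hz.2.le.trans hy.2.le⟩
      simp [hz'] at this
      linarith
    intro x hx y hy h
    rcases lt_trichotomy x y with h1 | h1 | h1
    · exact absurd h (aux x hx y hy h1)
    · exact h1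
    · exact absurd h.symm (aux y hy x hx h1)
  have hsplit : ∀ s r, η s + EuclideanSpace.single j r
      = EuclideanSpace.single i (η s i) + EuclideanSpace.single j (η s j + r) := by
    intro s r
    ext k
    fin_cases i <;> fin_cases j <;> fin_cases k <;> simp at hij ⊢
  calc ∫⁻ s in Ico a b, ∫⁻ r : ℝ, Q (η s + EuclideanSpace.single j r)
      = ∫⁻ s in Ico a b,
          ∫⁻ r : ℝ, Q (EuclideanSpace.single i (η s i) + EuclideanSpace.single j r) := by
        refine lintegral_congr fun s => ?_
        simp_rw [hsplit s]
        exact lintegral_add_left_eq_self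
          (fun r => Q (EuclideanSpace.single i (η s i) + EuclideanSpace.single j r)) _
    _ ≤ ∫⁻ s in Ico a b, ENNReal.ofReal c⁻¹ * (ENNReal.ofReal |η' s i| *
          ∫⁻ r : ℝ, Q (EuclideanSpace.single i (η s i) + EuclideanSpace.single j r)) := by
        refine setLIntegral_mono' measurableSet_Ico fun s hs => ?_
        rw [← mul_assoc, ← ENNReal.ofReal_mul (by positivity)]
        refine le_mul_of_one_le_left zero_le ?_
        rw [ENNReal.one_le_ofReal]
        have := hη' s ⟨hs.1, hs.2.le⟩
        rw [inv_mul_eq_div, le_div_iff₀ hc]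
        linarith
    _ = ENNReal.ofReal c⁻¹ * ∫⁻ x in (fun s => η s i) '' Ico a b,
          ∫⁻ r : ℝ, Q (EuclideanSpace.single i x + EuclideanSpace.single j r) := by
        rw [lintegral_const_mul' _ _ ENNReal.ofReal_ne_top,
          lintegral_image_eq_lintegral_abs_deriv_mul measurableSet_Ico
            (fun x _ => (hd i x).hasDerivWithinAt) hinj]
    _ ≤ _ := by
        gcongr
        rw [← lintegral_lintegral_single hij hQ]
        exact setLIntegral_le_lintegral _ _

/-! ### Weak gradients of affine functions -/

theorem integral_affine_mul_fderiv (d : ℝ) (b e : Plane) {φ : Plane → ℝ}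
    (hφ : ContDiff ℝ (⊤ : ℕ∞) φ) (hc : HasCompactSupport φ) :
    ∫ x, (d + inner ℝ b x) * fderiv ℝ φ x e = - ∫ x, inner ℝ b e * φ x := by
  have hfd : ∀ x : Plane, HasFDerivAt (fun x : Plane => d + inner ℝ b x) (innerSL ℝ b) x := fun x =>
    ((innerSL ℝ b).hasFDerivAt).const_add d
  have hcont : Continuous (fun x => fderiv ℝ φ x e) :=
    (hφ.continuous_fderiv (by simp)).clm_apply continuous_const
  have hcs : HasCompactSupport (fun x => fderiv ℝ φ x e) := hc.fderiv_apply ℝ e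
  have h := integral_mul_fderiv_eq_neg_fderiv_mul_of_integrable (μ := volume)
    (f := fun x : Plane => d + inner ℝ b x) (g := φ) (v := e) ?_ ?_ ?_
    (fun x _ => (hfd x).differentiableAt) (fun x _ => hφ.differentiable (by simp) x)
  · simpa [(hfd _).fderiv] using h
  · simp only [(hfd _).fderiv]
    exact (continuous_const.mul hφ.continuous).integrable_of_hasCompactSupport hc.mul_left
  · exact (Continuous.mul (by fun_prop) hcont).integrable_of_hasCompactSupport hcs.mul_left
  · exact (Continuous.mul (by fun_prop) hφ.continuous).integrable_of_hasCompactSupport hc.mul_left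

/-- Test functions supported in `W` see only the affine function, so the fundamental lemma of the
calculus of variations applies to `g - b`. The seminorm being an infimum over weak gradients, a
lower bound for it needs this for every competitor. -/
theorem IsWeakGradient.ae_eq_of_affine {U W : Set Plane} (hW : IsOpen W) (hWU : W ⊆ U)
    {v : Plane → ℝ} {g : Plane → Plane} (hg : IsWeakGradient U v g) (d : ℝ) (b : Plane)
    (hv : ∀ x ∈ W, v x = d + inner ℝ b x) : ∀ᵐ x, x ∈ W → g x = b := by
  have hgW : LocallyIntegrableOn g W := hg.2.1.mono_set hWU
  have h := hW.ae_eq_zero_of_integral_contDiff_smul_eq_zero (μ := volume) (f := fun x => g x - b)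
    (hgW.sub ((locallyIntegrable_const b).locallyIntegrableOn W)) ?_
  · filter_upwards [h] with x hx hxW
    exact sub_eq_zero.1 (hx hxW)
  intro φ hφ hc hs
  have hgi : Integrable (fun x => φ x • g x) := by
    have h1 : IntegrableOn g (tsupport φ) := hgW.integrableOn_compact_subset hs hc
    have h2 : IntegrableOn (fun x => φ x • g x) (tsupport φ) :=
      h1.continuousOn_smul hφ.continuous.continuousOn hc
    rwa [integrableOn_iff_integrable_of_support_subset] at h2
    intro x hx
    apply subset_tsupport
    intro h0
    simp [h0] at hx
  have hbi : Integrable (fun x => φ x • b) :=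
    (hφ.continuous.smul continuous_const).integrable_of_hasCompactSupport hc.smul_right
  have h0 : ∀ x ∉ W, φ x = 0 := fun x hx => image_eq_zero_of_notMem_tsupport fun h => hx (hs h)
  have h0' : ∀ x ∉ W, fderiv ℝ φ x = 0 := fun x hx =>
    image_eq_zero_of_notMem_tsupport fun h => hx (hs (tsupport_fderiv_subset ℝ h))
  refine ext_inner_left ℝ fun e => ?_
  have hi : Integrable (fun x => φ x • (g x - b)) := by
    simp only [smul_sub]
    exact hgi.sub hbi
  rw [← integral_inner hi, inner_zero_right]
  have h1 := hg.2.2 φ hφ hc (hs.trans hWU) e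
  rw [setIntegral_eq_integral_of_forall_compl_eq_zero
      (fun x hx => by simp [h0' x (fun h => hx (hWU h))]),
    setIntegral_eq_integral_of_forall_compl_eq_zero
      (fun x hx => by simp [h0 x (fun h => hx (hWU h))])] at h1
  have h2 : ∫ x, v x * fderiv ℝ φ x e = ∫ x, (d + inner ℝ b x) * fderiv ℝ φ x e := by
    refine integral_congr_ae (.of_forall fun x => ?_)
    by_cases hx : x ∈ W
    · simp only [hv x hx]
    · simp [h0' x hx]
  rw [h2, integral_affine_mul_fderiv d b e hφ hc, neg_inj] at h1
  have h3 : ∀ x, inner ℝ e (φ x • (g x - b)) = inner ℝ (g x) e * φ x - inner ℝ b e * φ x := by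
    intro x
    rw [inner_smul_right, inner_sub_right, real_inner_comm e, real_inner_comm e]
    ring
  simp_rw [h3]
  rw [integral_sub, h1, sub_self]
  · have := hgi.inner_const (𝕜 := ℝ) e
    refine this.congr (.of_forall fun x => ?_)
    simp only [inner_smul_left]; simp [mul_comm]
  · exact (continuous_const.mul hφ.continuous).integrable_of_hasCompactSupport hc.mul_left

/-! ### Broken affine functions -/

theorem affineMap_eq_inner (p : Plane →ᵃ[ℝ] ℝ) :
    ∃ (d : ℝ) (a : Plane), (∀ x, p x = d + inner ℝ a x) ∧ ∀ y, p.linear y = inner ℝ a y := by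
  refine ⟨p 0, (InnerProductSpace.toDual ℝ Plane).symm (LinearMap.toContinuousLinearMap p.linear),
    fun x => ?_, fun y => ?_⟩
  · rw [InnerProductSpace.toDual_symm_apply, LinearMap.coe_toContinuousLinearMap', add_comm]
    exact congrFun (AffineMap.decomp p) x
  · rw [InnerProductSpace.toDual_symm_apply, LinearMap.coe_toContinuousLinearMap']

/-- `w` is affine on the two parts of `S` on either side of a line, continuous across the line, and
the sizes of its two gradients are at most `M` and at least `M / κ`. -/
def IsBrokenAffineOn (κ : ℝ) (S : Set Plane) (w : Plane → ℝ) (M : ℝ) : Prop :=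
  ∃ (n a b : Plane) (e da db l : ℝ), n ≠ 0 ∧
    (∀ x ∈ S, inner ℝ n x ≤ e → w x = da + inner ℝ a x) ∧
    (∀ x ∈ S, e ≤ inner ℝ n x → w x = db + inner ℝ b x) ∧
    (∀ x, (da + inner ℝ a x) - (db + inner ℝ b x) = l * (inner ℝ n x - e)) ∧
    ‖a‖ ≤ M ∧ ‖b‖ ≤ M ∧ M ≤ κ * ‖a‖ ∧ M ≤ κ * ‖b‖

/-- The flux condition determines the jump: `l ‖n‖² = (β' / β - 1) ⟪b, n⟫`, so the jump is
controlled by either gradient. -/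
theorem norm_le_of_flux_eq {n a b : Plane} {l β β' : ℝ} (hn : n ≠ 0) (hβ : 0 < β)
    (hab : a = b + l • n) (hflux : β * inner ℝ a n = β' * inner ℝ b n) :
    ‖a‖ ≤ (1 + |β' / β - 1|) * ‖b‖ := by
  have hnn : 0 < ‖n‖ := norm_pos_iff.2 hn
  have h1 : l * ‖n‖ ^ 2 = (β' / β - 1) * inner ℝ b n := by
    rw [hab, inner_add_left, inner_smul_left, real_inner_self_eq_norm_sq] at hflux
    simp only [conj_trivial] at hflux
    field_simp
    linarith
  have h2 : |l| * ‖n‖ ≤ |β' / β - 1| * ‖b‖ := by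
    have : |l| * ‖n‖ ^ 2 ≤ |β' / β - 1| * (‖b‖ * ‖n‖) := by
      calc |l| * ‖n‖ ^ 2 = |l * ‖n‖ ^ 2| := by rw [abs_mul, abs_of_nonneg (sq_nonneg ‖n‖)]
        _ = |β' / β - 1| * |inner ℝ b n| := by rw [h1, abs_mul]
        _ ≤ _ := by gcongr; exact abs_real_inner_le_norm b n
    nlinarith
  calc ‖a‖ ≤ ‖b‖ + ‖l • n‖ := by rw [hab]; exact norm_add_le _ _
    _ = ‖b‖ + |l| * ‖n‖ := by rw [norm_smul, Real.norm_eq_abs]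
    _ ≤ _ := by linarith

/-- In the plane the orthogonal complement of `u` is a line. With `u = E - D`, continuity along the
cut makes the gradient jump normal. -/
theorem exists_smul_of_inner_eq_zero {u n f : Plane} (hu : u ≠ 0) (hn : n ≠ 0)
    (hun : inner ℝ n u = 0) (hfu : inner ℝ f u = 0) : ∃ l : ℝ, f = l • n := by
  have h1 : n 0 * u 0 + n 1 * u 1 = 0 := by
    simpa [PiLp.inner_apply, Fin.sum_univ_two, mul_comm] using hun
  have h2 : f 0 * u 0 + f 1 * u 1 = 0 := by
    simpa [PiLp.inner_apply, Fin.sum_univ_two, mul_comm] using hfu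
  have h3 : f 0 * n 1 = f 1 * n 0 := by
    have hu' : u 0 ≠ 0 ∨ u 1 ≠ 0 := by
      by_contra! h
      exact hu (by ext k; fin_cases k <;> simp [h])
    rcases hu' with h | h
    · apply mul_right_cancel₀ h; linear_combination n 1 * h2 - f 1 * h1
    · apply mul_right_cancel₀ h; linear_combination f 0 * h1 - n 0 * h2
  have hn' : n 0 ≠ 0 ∨ n 1 ≠ 0 := by
    by_contra! h
    exact hn (by ext k; fin_cases k <;> simp [h])
  rcases hn' with h | h
  · refine ⟨f 0 / n 0, ?_⟩
    ext k
    fin_cases k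
    · simp [h]
    · simp; field_simp; linarith
  · refine ⟨f 1 / n 1, ?_⟩
    ext k
    fin_cases k
    · simp; field_simp; linarith
    · simp [h]

theorem IsLocalIFE.exists_isBrokenAffineOn {G Ωm Ωp : Set Plane} {βm βp : ℝ} (hβm : 0 < βm)
    (hβp : 0 < βp) {K : Finset Plane} {w : Plane → ℝ} (hw : IsLocalIFE G Ωm Ωp βm βp K w) :
    ∃ M, IsBrokenAffineOn (1 + |βp / βm - 1| + |βm / βp - 1|) (hull K) w M := by
  by_cases hK : IsInterfaceElement G K
  · obtain ⟨D, E, n, pm, pp, hcut, hn, hnDE, -, -, hm, hp, hseg, hflux⟩ := hw.1 hK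
    obtain ⟨da, a, hpm, hpm'⟩ := affineMap_eq_inner pm
    obtain ⟨db, b, hpp, hpp'⟩ := affineMap_eq_inner pp
    have hD := hseg D (left_mem_segment ℝ D E)
    have hE := hseg E (right_mem_segment ℝ D E)
    rw [hpm, hpp] at hD hE
    obtain ⟨l, hl⟩ := exists_smul_of_inner_eq_zero (f := a - b) (sub_ne_zero.2 hcut.1.symm) hn hnDE
      (by simp only [inner_sub_left, inner_sub_right]; linarith)
    have hab : a = b + l • n := by rw [← hl]; abel
    have hba : b = a + (-l) • n := by rw [hab]; module
    rw [hpm', hpp'] at hflux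
    have h1 := norm_le_of_flux_eq hn hβm hab hflux
    have h2 := norm_le_of_flux_eq hn hβp hba hflux.symm
    have hmax : ∀ c : Plane, ‖a‖ ≤ (1 + |βp / βm - 1| + |βm / βp - 1|) * ‖c‖ →
        ‖b‖ ≤ (1 + |βp / βm - 1| + |βm / βp - 1|) * ‖c‖ →
        max ‖a‖ ‖b‖ ≤ (1 + |βp / βm - 1| + |βm / βp - 1|) * ‖c‖ := fun c => max_le
    have e1 : 0 ≤ |βp / βm - 1| := abs_nonneg _
    have e2 : 0 ≤ |βm / βp - 1| := abs_nonneg _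
    have na := norm_nonneg a
    have nb := norm_nonneg b
    refine ⟨max ‖a‖ ‖b‖, n, a, b, inner ℝ n D, da, db, l, hn, fun x hx hxn => ?_,
      fun x hx hxn => ?_, fun x => ?_, le_max_left _ _, le_max_right _ _,
      hmax a (by nlinarith) (by nlinarith), hmax b (by nlinarith) (by nlinarith)⟩
    · rw [hm x hx (by rw [inner_sub_right]; linarith), hpm]
    · rw [hp x hx (by rw [inner_sub_right]; linarith), hpp]
    · have h3 : ∀ y, inner ℝ a y = inner ℝ b y + l * inner ℝ n y := by
        intro y
        rw [hab, inner_add_left, inner_smul_left]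
        simp
      rw [h3] at hD ⊢
      linarith
  · obtain ⟨p, hp⟩ := hw.2 hK
    obtain ⟨d, a, hpa, -⟩ := affineMap_eq_inner p
    have e : ‖a‖ ≤ (1 + |βp / βm - 1| + |βm / βp - 1|) * ‖a‖ :=
      le_mul_of_one_le_left (norm_nonneg a)
        (by linarith [abs_nonneg (βp / βm - 1), abs_nonneg (βm / βp - 1)])
    -- Without a cut, any line will do, with the same affine function on both sides and `l = 0`.
    exact ⟨‖a‖, EuclideanSpace.single 0 1, a, a, 0, d, d, 0, by simp,
      fun x hx _ => by rw [hp x hx, hpa],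
      fun x hx _ => by rw [hp x hx, hpa], fun x => by simp, le_rfl, le_rfl, e, e⟩

theorem IsBrokenAffineOn.nonneg {κ : ℝ} {S : Set Plane} {w : Plane → ℝ} {M : ℝ}
    (h : IsBrokenAffineOn κ S w M) : 0 ≤ M := by
  obtain ⟨n, a, b, e, da, db, l, -, -, -, -, ha, -⟩ := h
  exact (norm_nonneg a).trans ha

/-- According to the sign of `l`, `w` is the minimum or the maximum of two affine functions, each
`M`-Lipschitz. -/
theorem IsBrokenAffineOn.abs_sub_le {κ : ℝ} {S : Set Plane} {w : Plane → ℝ} {M : ℝ}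
    (h : IsBrokenAffineOn κ S w M) {x y : Plane} (hx : x ∈ S) (hy : y ∈ S) :
    |w x - w y| ≤ M * ‖x - y‖ := by
  obtain ⟨n, a, b, e, da, db, l, -, h1, h2, h3, ha, hb, -⟩ := h
  have key : ∀ (d : ℝ) (c : Plane), ‖c‖ ≤ M →
      |(d + inner ℝ c x) - (d + inner ℝ c y)| ≤ M * ‖x - y‖ := by
    intro d c hc
    rw [add_sub_add_left_eq_sub, ← inner_sub_right]
    exact (abs_real_inner_le_norm _ _).trans (by gcongr)
  have hmm := max_le (key da a ha) (key db b hb)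
  rcases le_total 0 l with hl | hl
  · have hw : ∀ z ∈ S, w z = min (da + inner ℝ a z) (db + inner ℝ b z) := by
      intro z hz
      rcases le_total (inner ℝ n z) e with hze | hze
      · rw [h1 z hz hze, min_eq_left]; nlinarith [h3 z]
      · rw [h2 z hz hze, min_eq_right]; nlinarith [h3 z]
    rw [hw x hx, hw y hy]
    exact (abs_min_sub_min_le_max _ _ _ _).trans hmm
  · have hw : ∀ z ∈ S, w z = max (da + inner ℝ a z) (db + inner ℝ b z) := by
      intro z hz
      rcases le_total (inner ℝ n z) e with hze | hze
      · rw [h1 z hz hze, max_eq_left]; nlinarith [h3 z]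
      · rw [h2 z hz hze, max_eq_right]; nlinarith [h3 z]
    rw [hw x hx, hw y hy]
    exact (abs_max_sub_max_le_max _ _ _ _).trans hmm

theorem volume_inner_eq_const {n : Plane} (hn : n ≠ 0) (e : ℝ) :
    volume {x : Plane | inner ℝ n x = e} = 0 := by
  by_cases hne : {x : Plane | inner ℝ n x = e}.Nonempty
  · obtain ⟨D, hD⟩ := hne
    have h : {x : Plane | inner ℝ n x = e} ⊆
        (AffineSubspace.mk' D (LinearMap.ker (innerₛₗ ℝ n)) : Set Plane) := by
      intro x hx
      simp only [SetLike.mem_coe, AffineSubspace.mem_mk', LinearMap.mem_ker, innerₛₗ_apply_apply,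
        vsub_eq_sub, inner_sub_right]
      rw [mem_ofPred_eq] at hx hD
      rw [hx, hD, sub_self]
    refine measure_mono_null h (Measure.addHaar_affineSubspace _ _ fun htop => hn ?_)
    have := congrArg AffineSubspace.direction htop
    rw [AffineSubspace.direction_mk', AffineSubspace.direction_top] at this
    have hmem : n ∈ LinearMap.ker (innerₛₗ ℝ n) := this ▸ Submodule.mem_top
    simpa using hmem
  · rw [not_nonempty_iff_eq_empty.1 hne, measure_empty]

/-- Off a null line every weak gradient equals `a` or `b`, and both have size at least `M / κ`. It
is the lower bound on both sides that makes the estimate independent of the position of the cut. -/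
theorem IsBrokenAffineOn.mul_volume_le_h1SemiSq {κ : ℝ} (hκ : 0 < κ) {S U : Set Plane}
    {w v : Plane → ℝ} {M : ℝ} (h : IsBrokenAffineOn κ S w M) (hU : IsOpen U) (hUS : U ⊆ S)
    (hv : ∀ x ∈ U, v x = w x) :
    ENNReal.ofReal (M ^ 2) * volume U ≤ ENNReal.ofReal (κ ^ 2) * h1SemiSq U v := by
  have hM := h.nonneg
  obtain ⟨n, a, b, e, da, db, l, hn, h1, h2, h3, -, -, ha, hb⟩ := h
  have hκ' : ENNReal.ofReal (κ ^ 2) ≠ 0 := by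
    simpa using hκ.ne'
  rw [h1SemiSq, ENNReal.mul_iInf_of_ne hκ' ENNReal.ofReal_ne_top]
  refine le_iInf fun g => ?_
  rw [ENNReal.mul_iInf_of_ne hκ' ENNReal.ofReal_ne_top]
  refine le_iInf fun hg => ?_
  have hcont : Continuous fun x : Plane => inner ℝ n x := by fun_prop
  have hm := hg.ae_eq_of_affine (W := U ∩ {x | inner ℝ n x < e})
    (hU.inter (isOpen_lt hcont continuous_const)) inter_subset_left da a
    fun x hx => by rw [hv x hx.1, h1 x (hUS hx.1) (le_of_lt hx.2)]
  have hp := hg.ae_eq_of_affine (W := U ∩ {x | e < inner ℝ n x})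
    (hU.inter (isOpen_lt continuous_const hcont)) inter_subset_left db b
    fun x hx => by rw [hv x hx.1, h2 x (hUS hx.1) (le_of_lt hx.2)]
  have h0 : ∀ᵐ x : Plane, inner ℝ n x ≠ e := by
    rw [ae_iff]
    simpa using volume_inner_eq_const hn e
  rw [← setLIntegral_const, ← lintegral_const_mul' _ _ ENNReal.ofReal_ne_top]
  refine lintegral_mono_ae ?_
  rw [ae_restrict_iff' hU.measurableSet]
  filter_upwards [hm, hp, h0] with x hxm hxp hx0 hxU
  have hx : M ≤ κ * ‖g x‖ := by
    rcases lt_or_gt_of_ne hx0 with hlt | hlt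
    · rw [hxm ⟨hxU, hlt⟩]; exact ha
    · rw [hxp ⟨hxU, hlt⟩]; exact hb
  rw [← ofReal_norm, ← ENNReal.ofReal_pow (norm_nonneg _), ← ENNReal.ofReal_mul (sq_nonneg κ),
    ← mul_pow]
  exact ENNReal.ofReal_le_ofReal (by gcongr)

/-! ### Nodal interpolation -/

theorem exists_affine_interpolant {K : Finset Plane} (hcard : K.card = 3)
    (hK : AffineIndependent ℝ (fun A : K => (A : Plane))) (w : Plane → ℝ) :
    ∃ (d : ℝ) (b : Plane), ∀ A ∈ K, d + inner ℝ b A = w A := by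
  have htop : affineSpan ℝ (range fun A : K => (A : Plane)) = ⊤ := by
    rw [hK.affineSpan_eq_top_iff_card_eq_finrank_add_one]
    simp [hcard]
  let B : AffineBasis K ℝ Plane := ⟨fun A => (A : Plane), hK, htop⟩
  choose d b hdb _ using fun A : K => affineMap_eq_inner (B.coord A)
  refine ⟨∑ A : K, w A * d A, ∑ A : K, w A • b A, fun A hA => ?_⟩
  calc (∑ A' : K, w A' * d A') + inner ℝ (∑ A' : K, w A' • b A') A
      = ∑ A' : K, w A' * B.coord A' (B ⟨A, hA⟩) := by
        rw [sum_inner, ← Finset.sum_add_distrib]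
        refine Finset.sum_congr rfl fun A' _ => ?_
        rw [hdb A', inner_smul_left, conj_trivial, mul_add]
        rfl
    _ = w A := by simp [AffineBasis.coord_apply]

theorem isCompact_hull (K : Finset Plane) : IsCompact (hull K) :=
  K.finite_toSet.isCompact_convexHull ℝ

theorem inner_sub_le_of_mem_hull {K : Finset Plane} {b : Plane} {c : ℝ}
    (h : ∀ A ∈ K, ∀ B ∈ K, inner ℝ b A - inner ℝ b B ≤ c) {x y : Plane} (hx : x ∈ hull K)
    (hy : y ∈ hull K) : inner ℝ b x - inner ℝ b y ≤ c := by
  have hlin : ConvexOn ℝ univ (innerₛₗ ℝ b) := (innerₛₗ ℝ b).convexOn convex_univ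
  have hlin' : ConcaveOn ℝ univ (innerₛₗ ℝ b) := (innerₛₗ ℝ b).concaveOn convex_univ
  obtain ⟨A, hA, hxA⟩ := hlin.exists_ge_of_mem_convexHull (subset_univ _) hx
  obtain ⟨B, hB, hyB⟩ := hlin'.exists_le_of_mem_convexHull (subset_univ _) hy
  have := h A hA B hB
  rw [innerₛₗ_apply_apply, innerₛₗ_apply_apply] at hxA hyB
  linarith

/-- Estimates for the nodal interpolant of a broken affine function on a shape regular triangle. -/
theorem IsBrokenAffineOn.interpolation_estimates {κ : ℝ} (hκ : 0 < κ) {K : Finset Plane}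
    {w v : Plane → ℝ} {M : ℝ} (h : IsBrokenAffineOn κ (hull K) w M)
    (hv : ∀ x ∈ interior (hull K), v x = w x) {σ r : ℝ} {c : Plane} (hr : 0 < r)
    (hball : Metric.closedBall c r ⊆ hull K) (hσ : Metric.diam (hull K) ≤ σ * (2 * r))
    {d : ℝ} {b : Plane} (hnode : ∀ A ∈ K, d + inner ℝ b A = w A) {R : ℝ}
    (hR : Metric.diam (hull K) ≤ R) :
    (∀ x ∈ hull K, |w x - (d + inner ℝ b x)| ≤ 2 * M * Metric.diam (hull K)) ∧
    ENNReal.ofReal (‖b‖ ^ 2) * volume (hull K) ≤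
      ENNReal.ofReal (σ ^ 2 * κ ^ 2) * h1SemiSq (interior (hull K)) v ∧
    ENNReal.ofReal ((2 * M * Metric.diam (hull K)) ^ 2) ≤
      ENNReal.ofReal (16 * σ ^ 2 * κ ^ 2 / volume.real (Metric.ball (0 : Plane) 1)) *
        h1SemiSq (interior (hull K)) v ∧
    ENNReal.ofReal ((2 * M * Metric.diam (hull K)) ^ 2) * volume (hull K) ≤
      ENNReal.ofReal (4 * R ^ 2 * κ ^ 2) * h1SemiSq (interior (hull K)) v := by
  have hM := h.nonneg
  set D := Metric.diam (hull K) with hD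
  have hD0 : 0 ≤ D := Metric.diam_nonneg
  have hdist : ∀ x ∈ hull K, ∀ y ∈ hull K, ‖x - y‖ ≤ D := fun x hx y hy => by
    rw [← dist_eq_norm]
    exact Metric.dist_le_diam_of_mem (isCompact_hull K).isBounded hx hy
  have hKh : ∀ A ∈ K, A ∈ hull K := fun A hA => subset_convexHull ℝ _ hA
  -- A linear form attains its extremes at vertices, where the interpolant agrees with the
  -- `M`-Lipschitz function `w`.
  have hosc : ∀ x ∈ hull K, ∀ y ∈ hull K, inner ℝ b x - inner ℝ b y ≤ M * D := by
    intro x hx y hy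
    refine inner_sub_le_of_mem_hull (fun A hA B hB => ?_) hx hy
    have h1 := (le_abs_self _).trans (h.abs_sub_le (hKh A hA) (hKh B hB))
    rw [← hnode A hA, ← hnode B hB] at h1
    have h2 := mul_le_mul_of_nonneg_left (hdist A (hKh A hA) B (hKh B hB)) hM
    linarith
  -- The oscillation over the diameter of the inscribed disc in direction `b` is `2 r ‖b‖`, and it
  -- is at most `M D ≤ M σ (2 r)`. For `b = 0` only `0 ≤ σ` is needed.
  have hb : ‖b‖ ≤ σ * M := by
    rcases eq_or_ne b 0 with rfl | hb0
    · rw [norm_zero]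
      have : 0 ≤ σ := by
        by_contra! hneg
        nlinarith
      positivity
    have hbp : 0 < ‖b‖ := norm_pos_iff.2 hb0
    have hz : ‖(r / ‖b‖) • b‖ = r := by
      rw [norm_smul, Real.norm_of_nonneg (by positivity)]; field_simp
    have h1 := hosc (c + (r / ‖b‖) • b) (hball (by simp [hz])) (c - (r / ‖b‖) • b)
      (hball (by simp [hz]))
    rw [inner_add_right, inner_sub_right, inner_smul_right, real_inner_self_eq_norm_sq] at h1
    have h2 : r / ‖b‖ * ‖b‖ ^ 2 = r * ‖b‖ := by field_simp
    have h3 := mul_le_mul_of_nonneg_left hσ hM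
    rw [h2] at h1
    have h4 : (2 * r) * ‖b‖ ≤ (2 * r) * (σ * M) := by linarith
    exact le_of_mul_le_mul_left h4 (by positivity)
  have hvol : volume (interior (hull K)) = volume (hull K) :=
    measure_congr (interior_ae_eq_of_null_frontier ((convex_convexHull ℝ _).addHaar_frontier _))
  have hh1 := h.mul_volume_le_h1SemiSq hκ isOpen_interior interior_subset hv
  rw [hvol] at hh1
  have hmul : ∀ α β : ℝ, 0 ≤ β → α ≤ β * M ^ 2 → ENNReal.ofReal α * volume (hull K) ≤
      ENNReal.ofReal (β * κ ^ 2) * h1SemiSq (interior (hull K)) v := by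
    intro α β hβ hαβ
    calc ENNReal.ofReal α * volume (hull K)
        ≤ ENNReal.ofReal (β * M ^ 2) * volume (hull K) := by gcongr
      _ = ENNReal.ofReal β * (ENNReal.ofReal (M ^ 2) * volume (hull K)) := by
          rw [ENNReal.ofReal_mul hβ, mul_assoc]
      _ ≤ ENNReal.ofReal β * (ENNReal.ofReal (κ ^ 2) * h1SemiSq (interior (hull K)) v) := by gcongr
      _ = _ := by rw [ENNReal.ofReal_mul hβ, mul_assoc]
  have hne : K.Nonempty := by
    have : (hull K).Nonempty := ⟨c, hball (by simp [hr.le])⟩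
    exact Finset.coe_nonempty.1 (convexHull_nonempty_iff.1 this)
  obtain ⟨A, hA⟩ := hne
  refine ⟨fun x hx => ?_, ?_, ?_, ?_⟩
  · have h1 := abs_le.1 (h.abs_sub_le hx (hKh A hA))
    have h2 := mul_le_mul_of_nonneg_left (hdist x hx A (hKh A hA)) hM
    have h3 := hosc x hx A (hKh A hA)
    have h4 := hosc A (hKh A hA) x hx
    rw [← hnode A hA] at h1
    rw [abs_le]
    constructor <;> linarith [h1.1, h1.2]
  · refine hmul _ _ (sq_nonneg σ) ?_
    rw [← mul_pow]
    gcongr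
  · set ω := volume.real (Metric.ball (0 : Plane) 1) with hω
    have hω0 : 0 < ω := by
      rw [hω, measureReal_def, ENNReal.toReal_pos_iff]
      exact ⟨Metric.measure_ball_pos _ _ one_pos, measure_ball_lt_top⟩
    have hvr : ENNReal.ofReal (r ^ 2 * ω) ≤ volume (hull K) := by
      calc ENNReal.ofReal (r ^ 2 * ω) = volume (Metric.ball c r) := by
            rw [Measure.addHaar_ball _ _ hr.le, ENNReal.ofReal_mul (by positivity), hω,
              ofReal_measureReal measure_ball_lt_top.ne]
            simp
        _ ≤ _ := measure_mono (Metric.ball_subset_closedBall.trans hball)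
    -- `D ≤ 2 σ r` produces the factor `16 σ²`; the remaining `r²` is the area of the disc divided
    -- by `ω`.
    have h5 : (2 * M * D) ^ 2 ≤ (16 * σ ^ 2 / ω * M ^ 2) * (r ^ 2 * ω) := by
      have : D ^ 2 ≤ (σ * (2 * r)) ^ 2 := by gcongr
      calc (2 * M * D) ^ 2 = 4 * M ^ 2 * D ^ 2 := by ring
        _ ≤ 4 * M ^ 2 * (σ * (2 * r)) ^ 2 := by gcongr
        _ = _ := by field_simp; ring
    calc ENNReal.ofReal ((2 * M * D) ^ 2)
        ≤ ENNReal.ofReal ((16 * σ ^ 2 / ω * M ^ 2) * (r ^ 2 * ω)) := ENNReal.ofReal_le_ofReal h5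
      _ = ENNReal.ofReal (16 * σ ^ 2 / ω * M ^ 2) * ENNReal.ofReal (r ^ 2 * ω) :=
          ENNReal.ofReal_mul (by positivity)
      _ ≤ ENNReal.ofReal (16 * σ ^ 2 / ω * M ^ 2) * volume (hull K) := by gcongr
      _ ≤ ENNReal.ofReal (16 * σ ^ 2 / ω * κ ^ 2) * h1SemiSq (interior (hull K)) v :=
          hmul _ _ (by positivity) le_rfl
      _ = _ := by rw [div_mul_eq_mul_div]
  · refine hmul _ _ (by positivity) ?_
    have : D ^ 2 ≤ R ^ 2 := by gcongr
    nlinarith [mul_le_mul_of_nonneg_left this (sq_nonneg M)]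

/-! ### Uniform bounds for the moving interface -/

variable {Ω : Set Plane} {T : ℝ}

/-- The parametrization is `C¹` only on the closed time slab, so the spatial derivative is read off
from the derivative within it; this gives joint continuity up to the end times. -/
theorem MovingInterface.hasDerivAt_fderivWithin (Γ : MovingInterface Ω T) {t : ℝ}
    (ht : t ∈ Icc 0 T) (s : ℝ) :
    HasDerivAt (Γ.γ t)
      (fderivWithin ℝ (fun p : ℝ × ℝ => Γ.γ p.1 p.2) (Icc 0 T ×ˢ univ) (t, s) (0, 1)) s := by
  have h1 := ((Γ.smooth.differentiableOn one_ne_zero) (t, s) ⟨ht, mem_univ s⟩).hasFDerivWithinAt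
  have h2 : HasDerivWithinAt (fun s : ℝ => (t, s)) ((0 : ℝ), (1 : ℝ)) univ s :=
    ((hasDerivAt_const s t).prodMk (hasDerivAt_id s)).hasDerivWithinAt
  exact (h1.comp_hasDerivWithinAt s h2 fun x _ => ⟨ht, mem_univ x⟩).hasDerivAt Filter.univ_mem

theorem MovingInterface.continuousOn_deriv (hT : 0 < T) (Γ : MovingInterface Ω T) :
    ContinuousOn (fun p : ℝ × ℝ => deriv (Γ.γ p.1) p.2) (Icc 0 T ×ˢ univ) := by
  have h := Γ.smooth.continuousOn_fderivWithin ((uniqueDiffOn_Icc hT).prod uniqueDiffOn_univ) le_rfl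
  have h' := h.clm_apply (continuousOn_const (c := ((0 : ℝ), (1 : ℝ))))
  exact h'.congr fun p hp => (Γ.hasDerivAt_fderivWithin hp.1 p.2).deriv

theorem exists_half_le_abs_coord {c : ℝ} (hc : 0 < c) {x : Plane} (hx : c ≤ ‖x‖) :
    ∃ i : Fin 2, c / 2 ≤ |x i| := by
  by_contra! hcon
  have h2 : ‖x‖ ^ 2 < c ^ 2 := by
    rw [EuclideanSpace.norm_sq_eq, Fin.sum_univ_two]
    have h3 := hcon 0
    have h4 := hcon 1
    rw [← Real.norm_eq_abs] at h3 h4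
    have h5 := mul_self_lt_mul_self (norm_nonneg _) h3
    have h6 := mul_self_lt_mul_self (norm_nonneg _) h4
    nlinarith
  exact absurd (pow_le_pow_left₀ hc.le hx 2) (not_le.2 h2)

/-- On each interval of a partition of `[0, 1]`, which is independent of the time, the curve is a
graph over one of the axes, with a uniform bound on the slope. -/
theorem MovingInterface.exists_graph_partition (hT : 0 < T) (Γ : MovingInterface Ω T) :
    ∃ (c : ℝ) (N : ℕ), 0 < c ∧ 0 < N ∧ ∀ t ∈ Icc 0 T, ∀ k < N, ∃ i : Fin 2,
      ∀ s ∈ Icc ((k : ℝ) / N) ((k + 1) / N), c ≤ |deriv (Γ.γ t) s i| := by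
  have hcpt : IsCompact (Icc 0 T ×ˢ Icc (0 : ℝ) 1) := isCompact_Icc.prod isCompact_Icc
  have hcont := (Γ.continuousOn_deriv hT).mono (prod_mono_right (subset_univ (Icc (0 : ℝ) 1)))
  obtain ⟨p, hp, hmin⟩ := hcpt.exists_isMinOn 
    (nonempty_Icc.2 hT.le |>.prod (nonempty_Icc.2 zero_le_one))
    hcont.norm
  have hc0 : 0 < ‖deriv (Γ.γ p.1) p.2‖ := norm_pos_iff.2 (Γ.regular p.1 hp.1 p.2)
  have hmin' : ∀ t ∈ Icc 0 T, ∀ s ∈ Icc (0 : ℝ) 1, ‖deriv (Γ.γ p.1) p.2‖ ≤ ‖deriv (Γ.γ t) s‖ :=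
    fun t ht s hs => isMinOn_iff.1 hmin (t, s) (mk_mem_prod ht hs)
  clear hmin
  generalize ‖deriv (Γ.γ p.1) p.2‖ = c at hc0 hmin'
  -- At the left end of each piece some coordinate of the velocity is at least `c / 2`; a variation
  -- below `c / 4` leaves at least `c / 4`. The coordinate may depend on the time, but `c` and `N`
  -- do not.
  obtain ⟨ε, hε, hunif⟩ := Metric.uniformContinuousOn_iff.1
    (hcpt.uniformContinuousOn_of_continuous hcont) (c / 4) (by positivity)
  obtain ⟨N, hN0, hn⟩ := Real.exists_nat_pos_inv_lt hε
  have hN : (0 : ℝ) < N := by exact_mod_cast hN0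
  refine ⟨c / 4, N, by positivity, hN0, fun t ht k hk => ?_⟩
  have hsub : Icc ((k : ℝ) / N) ((k + 1) / N) ⊆ Icc 0 1 := by
    refine Icc_subset_Icc (by positivity) ?_
    rw [div_le_one hN]
    exact_mod_cast hk
  have hle : (k : ℝ) / N ≤ (k + 1) / N := by gcongr; linarith
  have hk0 := hsub (left_mem_Icc.2 hle)
  have hlow := hmin' t ht _ hk0
  obtain ⟨i, hi⟩ := exists_half_le_abs_coord hc0 hlow
  refine ⟨i, fun s hs => ?_⟩
  have hd := hunif (t, s) (mk_mem_prod ht (hsub hs)) (t, (k : ℝ) / N)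
    (mk_mem_prod ht hk0) (by
      rw [Prod.dist_eq, dist_self, max_eq_right dist_nonneg, Real.dist_eq, abs_of_nonneg
        (sub_nonneg.2 hs.1)]
      refine lt_of_le_of_lt ?_ hn
      have := hs.2
      rw [add_div, one_div] at this
      linarith)
  rw [dist_eq_norm] at hd
  have h1 := PiLp.norm_apply_le
    (deriv (Γ.γ t) s - deriv (Γ.γ t) ((k : ℝ) / N)) i
  rw [PiLp.sub_apply, Real.norm_eq_abs, abs_sub_comm] at h1
  have h2 := abs_sub_abs_le_abs_sub (deriv (Γ.γ t) ((k : ℝ) / N) i) (deriv (Γ.γ t) s i)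
  linarith

theorem MovingInterface.exists_norm_deriv_le (hT : 0 < T) (Γ : MovingInterface Ω T) :
    ∃ B : ℝ, ∀ t ∈ Icc 0 T, ∀ s ∈ Icc (0 : ℝ) 1, ‖deriv (Γ.γ t) s‖ ≤ B := by
  obtain ⟨B, hB⟩ := (isCompact_Icc.prod isCompact_Icc).exists_bound_of_continuousOn
    ((Γ.continuousOn_deriv hT).mono (prod_mono_right (subset_univ (Icc (0 : ℝ) 1))))
  exact ⟨B, fun t ht s hs => hB (t, s) (mk_mem_prod ht hs)⟩

/-- The curves at all times sweep out a compact subset of the open set `Ω`, and some closed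
thickening of it remains inside. -/
theorem MovingInterface.exists_add_mem (hΩ : IsOpen Ω) (Γ : MovingInterface Ω T) :
    ∃ δ : ℝ, 0 < δ ∧ ∀ t ∈ Icc 0 T, ∀ s ∈ Icc (0 : ℝ) 1, ∀ y : Plane, ‖y‖ ≤ δ →
      Γ.γ t s + y ∈ Ω := by
  have hcpt := (isCompact_Icc.prod isCompact_Icc).image_of_continuousOn
    (Γ.smooth.continuousOn.mono (prod_mono_right (subset_univ (Icc (0 : ℝ) 1))))
  obtain ⟨δ, hδ, hsub⟩ := hcpt.exists_cthickening_subset_open hΩ (by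
    rintro _ ⟨p, hp, rfl⟩
    exact Γ.mem_domain p.1 hp.1 p.2)
  refine ⟨δ, hδ, fun t ht s hs y hy => hsub ?_⟩
  exact Metric.mem_cthickening_of_dist_le _ (Γ.γ t s) _ _ ⟨(t, s), mk_mem_prod ht hs, rfl⟩
    (by simpa using hy)

/-- If the integrals of `Q` over all lines parallel to the axes through the points of a curve
bound a function `W` on the curve, then the integral of `Q` over the plane bounds that of `W`. -/
theorem lintegral_curve_le {η η' : ℝ → Plane} (hη : ∀ s, HasDerivAt η (η' s) s) {c δ : ℝ}
    (hc : 0 < c) (hδ : 0 < δ) {N : ℕ} (hN : 0 < N)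
    (hη' : ∀ k < N, ∃ i : Fin 2, ∀ s ∈ Icc ((k : ℝ) / N) ((k + 1) / N), c ≤ |η' s i|)
    {Q : Plane → ℝ≥0∞} (hQ : Measurable Q) {W : ℝ → ℝ≥0∞}
    (hW : ∀ s ∈ Ico (0 : ℝ) 1, ∀ j,
      ENNReal.ofReal δ * W s ≤ ∫⁻ r : ℝ, Q (η s + EuclideanSpace.single j r)) :
    ∫⁻ s in Ico (0 : ℝ) 1, W s ≤ ENNReal.ofReal (N / (c * δ)) * ∫⁻ z, Q z := by
  have hN' : (0 : ℝ) < N := by exact_mod_cast hN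
  have hcov : Ico (0 : ℝ) 1 ⊆
      ⋃ k : Fin N, Ico (0 : ℝ) 1 ∩ Ico ((k : ℝ) / N) ((k + 1) / N) := by
    intro s hs
    have hlt : ⌊s * N⌋₊ < N := by
      rw [Nat.floor_lt (by have := hs.1; positivity)]
      nlinarith [hs.2]
    refine mem_iUnion.2 ⟨⟨_, hlt⟩, hs, ?_, ?_⟩
    · rw [div_le_iff₀ hN']
      exact Nat.floor_le (by have := hs.1; positivity)
    · rw [lt_div_iff₀ hN']
      exact Nat.lt_floor_add_one _
  have hpiece : ∀ k : Fin N, ∫⁻ s in Ico (0 : ℝ) 1 ∩ Ico ((k : ℝ) / N) ((k + 1) / N), W s ≤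
      ENNReal.ofReal (1 / (c * δ)) * ∫⁻ z, Q z := by
    intro k
    obtain ⟨i, hi⟩ := hη' k k.2
    -- The arc is a graph over axis `i`, so it is translated along the other axis.
    obtain ⟨j, hij⟩ := exists_ne i
    have hδ' : ENNReal.ofReal δ⁻¹ * ENNReal.ofReal δ = 1 := by
      rw [← ENNReal.ofReal_mul (by positivity), inv_mul_cancel₀ hδ.ne', ENNReal.ofReal_one]
    calc ∫⁻ s in Ico (0 : ℝ) 1 ∩ Ico ((k : ℝ) / N) ((k + 1) / N), W s
        ≤ ∫⁻ s in Ico (0 : ℝ) 1 ∩ Ico ((k : ℝ) / N) ((k + 1) / N),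
            ENNReal.ofReal δ⁻¹ * ∫⁻ r : ℝ, Q (η s + EuclideanSpace.single j r) := by
          refine setLIntegral_mono' (measurableSet_Ico.inter measurableSet_Ico) fun s hs => ?_
          calc W s = ENNReal.ofReal δ⁻¹ * (ENNReal.ofReal δ * W s) := by
                rw [← mul_assoc, hδ', one_mul]
            _ ≤ _ := by gcongr; exact hW s hs.1 j
      _ ≤ ∫⁻ s in Ico ((k : ℝ) / N) ((k + 1) / N),
            ENNReal.ofReal δ⁻¹ * ∫⁻ r : ℝ, Q (η s + EuclideanSpace.single j r) :=
          lintegral_mono_set inter_subset_right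
      _ ≤ ENNReal.ofReal δ⁻¹ * (ENNReal.ofReal c⁻¹ * ∫⁻ z, Q z) := by
          rw [lintegral_const_mul' _ _ ENNReal.ofReal_ne_top]
          gcongr
          exact lintegral_curve_strip_le hij.symm hQ hη hc hi
      _ = _ := by
          rw [← mul_assoc, ← ENNReal.ofReal_mul (by positivity), one_div, mul_inv, mul_comm c⁻¹]
  calc ∫⁻ s in Ico (0 : ℝ) 1, W s
      ≤ ∑ k : Fin N, ∫⁻ s in Ico (0 : ℝ) 1 ∩ Ico ((k : ℝ) / N) ((k + 1) / N), W s := by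
        exact (lintegral_mono_set hcov).trans ((lintegral_iUnion_le _ _).trans_eq (tsum_fintype _))
    _ ≤ ∑ _k : Fin N, ENNReal.ofReal (1 / (c * δ)) * ∫⁻ z, Q z :=
        Finset.sum_le_sum fun k _ => hpiece k
    _ = _ := by
        rw [Finset.sum_const, Finset.card_univ, Fintype.card_fin, nsmul_eq_mul, ← mul_assoc,
          ← ENNReal.ofReal_natCast, ← ENNReal.ofReal_mul hN'.le, mul_one_div]

/-! ### Continuous piecewise affine functions -/

/-- The density whose integral controls the trace of the function that is
`d K + ⟪b K, x⟫` on each triangle `K`. -/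
noncomputable def traceDensity (cells : Finset (Finset Plane)) (d : Finset Plane → ℝ)
    (b : Finset Plane → Plane)
    (δ : ℝ) (x : Plane) : ℝ≥0∞ :=
  ∑ K ∈ cells, (hull K).indicator
    (fun x => ENNReal.ofReal (2 * (d K + inner ℝ (b K) x) ^ 2) +
      ENNReal.ofReal (2 * δ ^ 2 * ‖b K‖ ^ 2)) x

theorem measurable_traceDensity (cells : Finset (Finset Plane)) (d : Finset Plane → ℝ)
    (b : Finset Plane → Plane) (δ : ℝ) : Measurable (traceDensity cells d b δ) := by
  refine Finset.measurable_fun_sum _ fun K _ =>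
    Measurable.indicator ?_ (isCompact_hull K).measurableSet
  fun_prop

theorem lintegral_traceDensity (cells : Finset (Finset Plane)) (d : Finset Plane → ℝ)
    (b : Finset Plane → Plane) (δ : ℝ) : ∫⁻ x, traceDensity cells d b δ x =
      ∑ K ∈ cells, ((∫⁻ x in hull K, ENNReal.ofReal (2 * (d K + inner ℝ (b K) x) ^ 2)) +
        ENNReal.ofReal (2 * δ ^ 2 * ‖b K‖ ^ 2) * volume (hull K)) := by
  simp only [traceDensity]
  rw [lintegral_finsetSum _ fun K _ =>
    Measurable.indicator (by fun_prop) (isCompact_hull K).measurableSet]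
  refine Finset.sum_congr rfl fun K _ => ?_
  rw [lintegral_indicator (isCompact_hull K).measurableSet, lintegral_add_right _ measurable_const,
    setLIntegral_const]

/-- Along the segment, `f 0 ^ 2 ≤ 2 f r ^ 2 + 2 (f r - f 0) ^ 2`, and Cauchy-Schwarz bounds the
squared increment by `δ` times the integral of the squared gradient. Integrating over `r` in `[0,
δ]` gives the claim. The segment may run along an edge; its length is then counted in each adjacent
triangle, which only enlarges the right side. -/
theorem ofReal_mul_sq_le_lintegral_traceDensity {cells : Finset (Finset Plane)}
    {d : Finset Plane → ℝ} {b : Finset Plane → Plane}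
    (hcons : ∀ K ∈ cells, ∀ L ∈ cells, ∀ x ∈ hull K ∩ hull L,
      d K + inner ℝ (b K) x = d L + inner ℝ (b L) x) {δ : ℝ} (hδ : 0 < δ) {z : Plane} {j : Fin 2}
    (hz : ∀ r ∈ Icc 0 δ, ∃ K ∈ cells, z + EuclideanSpace.single j r ∈ hull K)
    {K₀ : Finset Plane} (hK₀ : K₀ ∈ cells) (hzK₀ : z ∈ hull K₀) :
    ENNReal.ofReal δ * ENNReal.ofReal ((d K₀ + inner ℝ (b K₀) z) ^ 2) ≤
      ∫⁻ r : ℝ, traceDensity cells d b δ (z + EuclideanSpace.single j r) := by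
  classical
  have hz' : ∀ r : ℝ, ∃ K, r ∈ Icc 0 δ → K ∈ cells ∧ z + EuclideanSpace.single j r ∈ hull K := by
    intro r
    by_cases hr : r ∈ Icc 0 δ
    · obtain ⟨K, hK⟩ := hz r hr
      exact ⟨K, fun _ => hK⟩
    · exact ⟨∅, fun h => absurd h hr⟩
  choose κ hκ using hz'
  have hP : ∀ r : ℝ, z + EuclideanSpace.single j r =
      AffineMap.lineMap z (z + EuclideanSpace.single j (1 : ℝ)) r := by
    intro r
    ext l
    simp [AffineMap.lineMap_apply, add_comm]
  have hcont : Continuous fun r : ℝ => z + EuclideanSpace.single j r := by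
    rw [funext hP]
    exact AffineMap.lineMap_continuous
  set A : Finset Plane → Set ℝ :=
    fun K => (fun r : ℝ => z + EuclideanSpace.single j r) ⁻¹' hull K ∩ Icc 0 δ with hA
  have hAcl : ∀ K, IsClosed (A K) := fun K =>
    ((isCompact_hull K).isClosed.preimage hcont).inter isClosed_Icc
  have hAoc : ∀ K, (A K).OrdConnected := by
    intro K
    refine Convex.ordConnected (𝕜 := ℝ) (Convex.inter ?_ (convex_Icc 0 δ))
    rw [funext hP]
    exact (convex_convexHull ℝ _).affine_preimage _
  -- The choice `κ r` of a triangle is immaterial by `hcons`.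
  set f : ℝ → ℝ := fun r => d (κ r) + inner ℝ (b (κ r)) (z + EuclideanSpace.single j r) with hf
  have hfA : ∀ K ∈ cells, ∀ r ∈ A K,
      f r = d K + inner ℝ (b K) (z + EuclideanSpace.single j r) := fun K hK r hr =>
    hcons _ (hκ r hr.2).1 K hK _ ⟨(hκ r hr.2).2, hr.1⟩
  have hcover : Icc 0 δ ⊆ ⋃ K ∈ cells, A K := fun r hr =>
    mem_biUnion (hκ r hr).1 ⟨(hκ r hr).2, hr⟩
  have hAfin : ∀ K, volume (A K) ≠ ∞ := fun K =>
    ((measure_mono inter_subset_right).trans_lt measure_Icc_lt_top).ne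
  set S : ℝ := ∑ K ∈ cells, ‖b K‖ ^ 2 * volume.real (A K) with hS
  have hinc : ∀ r ∈ Icc 0 δ, (f r - f 0) ^ 2 ≤ δ * S := by
    intro r hr
    refine (sq_sub_le_of_cover f A (fun K => ‖b K‖) r _ cells rfl (fun K _ => hAcl K)
      (fun K _ => hAoc K) (fun K hK x hx y hy => ?_) 0 hr.1
      ((Icc_subset_Icc_right hr.2).trans hcover)).trans ?_
    · rw [hfA K hK x hx, hfA K hK y hy, add_sub_add_left_eq_sub, ← inner_sub_right]
      refine (abs_real_inner_le_norm _ _).trans_eq ?_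
      have hxy : (EuclideanSpace.single j x - EuclideanSpace.single j y : Plane)
          = EuclideanSpace.single j (x - y) := by
        ext l
        fin_cases j <;> fin_cases l <;> simp
      rw [add_sub_add_left_eq_sub, hxy, PiLp.norm_single, Real.norm_eq_abs]
    · rw [sub_zero, hS]
      gcongr
      · exact hr.2
      · exact hAfin _
      · exact inter_subset_left
  have hf0 : ∀ r ∈ Icc 0 δ, (d K₀ + inner ℝ (b K₀) z) ^ 2 ≤ 2 * f r ^ 2 + 2 * (δ * S) := by
    intro r hr
    have h0 : f 0 = d K₀ + inner ℝ (b K₀) z := by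
      have hz0 : z + EuclideanSpace.single j (0 : ℝ) = z := by
        ext l
        simp
      rw [hfA K₀ hK₀ 0 ⟨by rwa [mem_preimage, hz0], left_mem_Icc.2 hδ.le⟩, hz0]
    rw [← h0]
    nlinarith [hinc r hr, sq_nonneg (2 * f r - f 0)]
  set g : ℝ → ℝ≥0∞ := fun r => ∑ K ∈ cells, (A K).indicator
    (fun _ => ENNReal.ofReal (2 * δ ^ 2 * ‖b K‖ ^ 2)) r with hg
  have hgm : Measurable g := Finset.measurable_fun_sum _ fun K _ =>
    measurable_const.indicator (hAcl K).measurableSet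
  have hgint : ∫⁻ r in Icc 0 δ, g r = ENNReal.ofReal δ * ENNReal.ofReal (2 * (δ * S)) := by
    rw [hg, lintegral_finsetSum _ fun K _ => measurable_const.indicator (hAcl K).measurableSet,
      ← ENNReal.ofReal_mul hδ.le, hS, Finset.mul_sum, Finset.mul_sum, Finset.mul_sum,
      ENNReal.ofReal_sum_of_nonneg fun K _ => by positivity]
    refine Finset.sum_congr rfl fun K _ => ?_
    rw [lintegral_indicator_const (hAcl K).measurableSet,
      Measure.restrict_apply (hAcl K).measurableSet, inter_eq_left.2 inter_subset_right,
      ← ofReal_measureReal (hAfin K), ← ENNReal.ofReal_mul (by positivity)]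
    congr 1
    ring
  set g₁ : ℝ → ℝ≥0∞ := fun r => ∑ K ∈ cells, (A K).indicator
    (fun r => ENNReal.ofReal (2 * (d K + inner ℝ (b K) (z + EuclideanSpace.single j r)) ^ 2)) r
    with hg₁
  have hadd : ∀ r ∈ Icc 0 δ, g₁ r + g r =
      traceDensity cells d b δ (z + EuclideanSpace.single j r) := by
    intro r hr
    rw [hg, hg₁, ← Finset.sum_add_distrib]
    refine Finset.sum_congr rfl fun K _ => ?_
    by_cases hrK : z + EuclideanSpace.single j r ∈ hull K
    · have : r ∈ A K := ⟨hrK, hr⟩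
      simp only [indicator_of_mem this, indicator_of_mem hrK]
    · have : r ∉ A K := fun h => hrK h.1
      simp only [indicator_of_notMem this, indicator_of_notMem hrK, add_zero]
  have hle : ∀ r ∈ Icc 0 δ, ENNReal.ofReal ((d K₀ + inner ℝ (b K₀) z) ^ 2) ≤
      g₁ r + ENNReal.ofReal (2 * (δ * S)) := by
    intro r hr
    have hrA : r ∈ A (κ r) := ⟨(hκ r hr).2, hr⟩
    calc ENNReal.ofReal ((d K₀ + inner ℝ (b K₀) z) ^ 2)
        ≤ ENNReal.ofReal (2 * f r ^ 2) + ENNReal.ofReal (2 * (δ * S)) :=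
          (ENNReal.ofReal_le_ofReal (hf0 r hr)).trans ENNReal.ofReal_add_le
      _ ≤ _ := by
          gcongr
          refine le_trans ?_ (Finset.single_le_sum (fun _ _ => zero_le) (hκ r hr).1)
          rw [indicator_of_mem hrA]
  calc ENNReal.ofReal δ * ENNReal.ofReal ((d K₀ + inner ℝ (b K₀) z) ^ 2)
      = ∫⁻ _ in Icc 0 δ, ENNReal.ofReal ((d K₀ + inner ℝ (b K₀) z) ^ 2) := by
        rw [setLIntegral_const, Real.volume_Icc, sub_zero, mul_comm]
    _ ≤ ∫⁻ r in Icc 0 δ, (g₁ r + ENNReal.ofReal (2 * (δ * S))) :=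
        setLIntegral_mono' measurableSet_Icc hle
    _ = (∫⁻ r in Icc 0 δ, g₁ r) + ∫⁻ r in Icc 0 δ, g r := by
        rw [lintegral_add_right _ measurable_const, hgint, setLIntegral_const, Real.volume_Icc,
          sub_zero, mul_comm (ENNReal.ofReal δ)]
    _ = ∫⁻ r in Icc 0 δ, traceDensity cells d b δ (z + EuclideanSpace.single j r) := by
        rw [← lintegral_add_right _ hgm]
        exact setLIntegral_congr_fun measurableSet_Icc hadd
    _ ≤ _ := setLIntegral_le_lintegral _ _

/-! ### The interface and the mesh -/

theorem Triangulation.hull_subset_closure (𝓣 : Triangulation Ω) {K : Finset Plane}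
    (hK : K ∈ 𝓣.cells) : hull K ⊆ closure Ω := by
  rw [← 𝓣.cover]
  exact subset_biUnion_of_mem (u := fun K => hull K) hK

theorem Triangulation.exists_mem_hull (𝓣 : Triangulation Ω) {x : Plane} (hx : x ∈ Ω) :
    ∃ K ∈ 𝓣.cells, x ∈ hull K := by
  have h := subset_closure hx
  rw [← 𝓣.cover] at h
  simpa using h

theorem Triangulation.diam_hull_le (𝓣 : Triangulation Ω) {K : Finset Plane}
    (hK : K ∈ 𝓣.cells) : Metric.diam (hull K) ≤ Metric.diam (closure Ω) := by
  refine Metric.diam_mono (𝓣.hull_subset_closure hK) ?_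
  rw [← 𝓣.cover]
  exact (𝓣.cells.isCompact_biUnion fun K _ => isCompact_hull K).isBounded

/-- Each element contributes at most its two cut points or its vertices. This matters because
functions in the space are prescribed only inside elements. -/
theorem Triangulation.Resolves.finite_diff_interior {𝓣 : Triangulation Ω} {G : Set Plane}
    (h : 𝓣.Resolves G) (hG : G ⊆ Ω) :
    (G \ ⋃ K ∈ 𝓣.cells, interior (hull K)).Finite := by
  refine (𝓣.cells.finite_toSet.biUnion
    (t := fun K => (G ∩ hull K) \ interior (hull K)) fun K hK => ?_).subset ?_
  · by_cases hi : IsInterfaceElement G K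
    · obtain ⟨D, E, -, hDE, -⟩ := (h K hK).1 hi
      refine (toFinite {D, E}).subset ?_
      rw [← hDE]
      exact fun x hx => ⟨hx.1.1, subset_closure hx.1.2, hx.2⟩
    · exact K.finite_toSet.subset (sdiff_subset.trans ((h K hK).2 hi))
  · intro x hx
    obtain ⟨K, hK, hxK⟩ := 𝓣.exists_mem_hull (hG hx.1)
    exact mem_biUnion (Finset.mem_coe.2 hK)
      ⟨⟨hx.1, hxK⟩, fun hxi => hx.2 (mem_biUnion hK hxi)⟩

theorem Triangulation.Resolves.ae_mem_interior {𝓣 : Triangulation Ω} {Γ : MovingInterface Ω T}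
    {t : ℝ} (ht : t ∈ Icc 0 T) (h : 𝓣.Resolves (Γ.curve t)) :
    ∀ᵐ s ∂(volume.restrict (Ico (0 : ℝ) 1)), ∃ K ∈ 𝓣.cells, Γ.γ t s ∈ interior (hull K) := by
  have hfin := h.finite_diff_interior (by
    rintro _ ⟨s, rfl⟩
    exact Γ.mem_domain t ht s)
  have hfin' : (Ico (0 : ℝ) 1 ∩
      Γ.γ t ⁻¹' (Γ.curve t \ ⋃ K ∈ 𝓣.cells, interior (hull K))).Finite := by
    refine Finite.of_finite_image (f := Γ.γ t) (hfin.subset ?_)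
      ((Γ.simple t ht).mono inter_subset_left)
    rintro _ ⟨s, hs, rfl⟩
    exact hs.2
  rw [ae_restrict_iff' measurableSet_Ico]
  filter_upwards [compl_mem_ae_iff.2 (hfin'.measure_zero volume)] with s hs hs1
  by_contra! hcon
  exact hs ⟨hs1, mem_range_self s, by simpa using hcon⟩

/-! ### The trace inequality -/

theorem enorm_sq_eq_ofReal (y : ℝ) : ‖y‖ₑ ^ 2 = ENNReal.ofReal (y ^ 2) := by
  rw [Real.enorm_eq_ofReal_abs, ← ENNReal.ofReal_pow (abs_nonneg y), sq_abs]

theorem ofReal_two_mul_sq_le {x y e k : ℝ} (hk : 0 ≤ k) (h : |y - x| ≤ e) :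
    ENNReal.ofReal (k * x ^ 2) ≤
      ENNReal.ofReal (2 * k) * ‖y‖ₑ ^ 2 + ENNReal.ofReal (2 * k) * ENNReal.ofReal (e ^ 2) := by
  rw [enorm_sq_eq_ofReal, ← ENNReal.ofReal_mul (by positivity),
    ← ENNReal.ofReal_mul (by positivity),
    ← ENNReal.ofReal_add (by positivity) (by positivity)]
  refine ENNReal.ofReal_le_ofReal ?_
  have h1 : (y - x) ^ 2 ≤ e ^ 2 := by
    rw [← sq_abs]
    gcongr
  nlinarith [mul_nonneg hk (sub_nonneg.2 h1), mul_nonneg hk (sq_nonneg (2 * y - x))]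

theorem setLIntegral_hull_le {K : Finset Plane} {v w : Plane → ℝ}
    (hv : ∀ x ∈ interior (hull K), v x = w x) {d e : ℝ} {b : Plane}
    (he : ∀ x ∈ hull K, |w x - (d + inner ℝ b x)| ≤ e) :
    ∫⁻ x in hull K, ENNReal.ofReal (2 * (d + inner ℝ b x) ^ 2) ≤
      ENNReal.ofReal 4 * l2Sq (interior (hull K)) v +
        ENNReal.ofReal 4 * (ENNReal.ofReal (e ^ 2) * volume (hull K)) := by
  have hae : interior (hull K) =ᵐ[volume] hull K :=
    interior_ae_eq_of_null_frontier ((convex_convexHull ℝ _).addHaar_frontier _)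
  rw [← Measure.restrict_congr_set hae, ← measure_congr hae, l2Sq, ← setLIntegral_const,
    ← lintegral_const_mul' _ _ ENNReal.ofReal_ne_top,
    ← lintegral_const_mul' _ _ ENNReal.ofReal_ne_top, ← lintegral_add_right _ (by fun_prop)]
  refine setLIntegral_mono' isOpen_interior.measurableSet fun x hx => ?_
  have h := ofReal_two_mul_sq_le zero_le_two (he x (interior_subset hx))
  rw [← hv x hx] at h
  norm_num at h ⊢
  exact h

end IFE

theorem mainTheorem6
    (Ω : Set IFE.Plane) (hΩ_open : IsOpen Ω) (hΩ_conn : IsConnected Ω)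
    (T : ℝ) (hT : 0 < T) (Γ : IFE.MovingInterface Ω T)
    (βm βp : ℝ) (hβm : 0 < βm) (hβp : 0 < βp) (σ q : ℝ) :
    ∃ C : ℝ, 0 < C ∧
      ∀ 𝓣 : IFE.Triangulation Ω, 𝓣.ShapeRegular σ → 𝓣.QuasiUniform q →
        ∀ t ∈ Set.Icc 0 T, 𝓣.Resolves (Γ.curve t) →
          ∀ v ∈ IFE.ifeSpace 𝓣 Γ βm βp t,
            IFE.interfaceL2Norm Γ t v ≤ ENNReal.ofReal C * IFE.brokenH1Norm 𝓣 v := by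
  obtain ⟨c, N, hc, hN, hgraph⟩ := Γ.exists_graph_partition hT
  obtain ⟨B, hB⟩ := Γ.exists_norm_deriv_le hT
  obtain ⟨δ, hδ, hadd⟩ := Γ.exists_add_mem hΩ_open
  have hB0 : 0 ≤ B := (norm_nonneg _).trans (hB 0 ⟨le_rfl, hT.le⟩ 0 ⟨le_rfl, zero_le_one⟩)
  set κ := 1 + |βp / βm - 1| + |βm / βp - 1| with hκ
  have hκ0 : 0 < κ := by positivity
  set R := Metric.diam (closure Ω) with hR
  set ω := volume.real (Metric.ball (0 : IFE.Plane) 1) with hω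
  have hω0 : 0 ≤ ω := measureReal_nonneg
  -- The terms account for the `L²` norm of the function, the `L²` interpolation error, and the
  -- gradient of the interpolant weighted by `2 δ²`.
  set C₁ := 4 + 4 * (4 * R ^ 2 * κ ^ 2) + 2 * δ ^ 2 * (σ ^ 2 * κ ^ 2) with hC₁
  -- `B` bounds the speed and each `2` comes from splitting a square; the two terms are the trace of
  -- the interpolant and the sup error.
  set C₂ := B * (2 * (N / (c * δ) * C₁) + 2 * (16 * σ ^ 2 * κ ^ 2 / ω)) with hC₂
  have hC₁0 : 0 ≤ C₁ := by positivity
  have hC₂0 : 0 ≤ C₂ := by positivity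
  refine ⟨√(C₂ + 1), by positivity, fun 𝓣 hshape _ t ht hres v hv => ?_⟩
  obtain ⟨w, hloc, hvw, hnode, -⟩ := hv
  have hlocal : ∀ K ∈ 𝓣.cells, ∃ (d : ℝ) (b : IFE.Plane) (e : ℝ),
      (∀ A ∈ K, d + inner ℝ b A = w K A) ∧
      (∀ x ∈ IFE.hull K, |w K x - (d + inner ℝ b x)| ≤ e) ∧
      ENNReal.ofReal (‖b‖ ^ 2) * volume (IFE.hull K) ≤
        ENNReal.ofReal (σ ^ 2 * κ ^ 2) * IFE.h1SemiSq (interior (IFE.hull K)) v ∧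
      ENNReal.ofReal (e ^ 2) ≤ ENNReal.ofReal (16 * σ ^ 2 * κ ^ 2 / ω) *
        IFE.h1SemiSq (interior (IFE.hull K)) v ∧
      ENNReal.ofReal (e ^ 2) * volume (IFE.hull K) ≤
        ENNReal.ofReal (4 * R ^ 2 * κ ^ 2) * IFE.h1SemiSq (interior (IFE.hull K)) v := by
    intro K hK
    obtain ⟨M, hM⟩ := (hloc K hK).exists_isBrokenAffineOn hβm hβp
    obtain ⟨d, b, hdb⟩ := IFE.exists_affine_interpolant (𝓣.card_eq K hK) (𝓣.indep K hK) (w K)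
    obtain ⟨x, r, hr, hball, hσ⟩ := hshape K hK
    exact ⟨d, b, _, hdb, hM.interpolation_estimates hκ0 (hvw K hK) hr hball hσ hdb
      (𝓣.diam_hull_le hK)⟩
  choose! d b e hdb hde hb he₁ he₂ using hlocal
  set H : Finset IFE.Plane → ENNReal := fun K => IFE.h1SemiSq (interior (IFE.hull K)) v with hH
  set E : ENNReal := ∑ K ∈ 𝓣.cells, (IFE.l2Sq (interior (IFE.hull K)) v + H K) with hE
  have hcons : ∀ K ∈ 𝓣.cells, ∀ L ∈ 𝓣.cells, ∀ x ∈ IFE.hull K ∩ IFE.hull L,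
      d K + inner ℝ (b K) x = d L + inner ℝ (b L) x := by
    intro K hK L hL x hx
    rw [𝓣.conforming K hK L hL] at hx
    -- Two affine functions agree on a convex set, so agreement at the common vertices suffices.
    refine convexHull_min (t := {x | d K + inner ℝ (b K) x = d L + inner ℝ (b L) x}) ?_ ?_ hx
    · rintro A ⟨hAK, hAL⟩
      rw [mem_ofPred_eq, hdb K hK A hAK, hdb L hL A hAL, hnode K hK L hL A hAK hAL]
    · intro x hx y hy p q _ _ hpq
      rw [mem_ofPred_eq] at hx hy ⊢
      simp only [inner_add_right, inner_smul_right]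
      linear_combination p * hx + q * hy + (d L - d K) * hpq
  have hdensity : ∫⁻ x, IFE.traceDensity 𝓣.cells d b δ x ≤ ENNReal.ofReal C₁ * E := by
    rw [IFE.lintegral_traceDensity, hE, Finset.mul_sum]
    refine Finset.sum_le_sum fun K hK => ?_
    calc _ ≤ (ENNReal.ofReal 4 * IFE.l2Sq (interior (IFE.hull K)) v +
            ENNReal.ofReal 4 * (ENNReal.ofReal (4 * R ^ 2 * κ ^ 2) * H K)) +
            ENNReal.ofReal (2 * δ ^ 2) * (ENNReal.ofReal (σ ^ 2 * κ ^ 2) * H K) := by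
          rw [ENNReal.ofReal_mul (by positivity : 0 ≤ 2 * δ ^ 2), mul_assoc (ENNReal.ofReal _)]
          exact add_le_add ((IFE.setLIntegral_hull_le (hvw K hK) (hde K hK)).trans
            (add_le_add le_rfl (mul_le_mul' le_rfl (he₂ K hK)))) (mul_le_mul' le_rfl (hb K hK))
      _ = ENNReal.ofReal 4 * IFE.l2Sq (interior (IFE.hull K)) v +
            ENNReal.ofReal (4 * (4 * R ^ 2 * κ ^ 2) + 2 * δ ^ 2 * (σ ^ 2 * κ ^ 2)) * H K := by
          rw [← mul_assoc, ← mul_assoc, ← ENNReal.ofReal_mul (by positivity),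
            ← ENNReal.ofReal_mul (by positivity), add_assoc, ← add_mul,
            ← ENNReal.ofReal_add (by positivity) (by positivity)]
      _ ≤ ENNReal.ofReal C₁ * IFE.l2Sq (interior (IFE.hull K)) v + ENNReal.ofReal C₁ * H K := by
          gcongr
          · rw [hC₁, add_assoc]
            exact le_add_of_nonneg_right (by positivity)
          · rw [hC₁, add_assoc]
            exact le_add_of_nonneg_left (by positivity)
      _ = _ := (mul_add _ _ _).symm
  have herr : ∑ K ∈ 𝓣.cells, ENNReal.ofReal (e K ^ 2) ≤
      ENNReal.ofReal (16 * σ ^ 2 * κ ^ 2 / ω) * E := by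
    rw [hE, Finset.mul_sum]
    refine Finset.sum_le_sum fun K hK => (he₁ K hK).trans ?_
    gcongr
    exact le_add_self
  clear_value C₁
  -- Any triangle containing the point will do, by `hcons`; the integral rules applied to `W`
  -- require no measurability of `ν`.
  choose ν hν using fun s => 𝓣.exists_mem_hull (Γ.mem_domain t ht s)
  set W : ℝ → ENNReal := fun s =>
    ENNReal.ofReal ((d (ν s) + inner ℝ (b (ν s)) (Γ.γ t s)) ^ 2) with hW
  have hWint : ∫⁻ s in Ico (0 : ℝ) 1, W s ≤
      ENNReal.ofReal (N / (c * δ)) * ∫⁻ x, IFE.traceDensity 𝓣.cells d b δ x := by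
    refine IFE.lintegral_curve_le
      (fun s => (Γ.hasDerivAt_fderivWithin ht s).differentiableAt.hasDerivAt) hc hδ hN
      (hgraph t ht) (IFE.measurable_traceDensity _ _ _ _) fun s hs j => ?_
    refine IFE.ofReal_mul_sq_le_lintegral_traceDensity hcons hδ (fun r hr => ?_) (hν s).1 (hν s).2
    refine 𝓣.exists_mem_hull (hadd t ht s ⟨hs.1, hs.2.le⟩ _ ?_)
    rw [PiLp.norm_single, Real.norm_of_nonneg hr.1]
    exact hr.2
  have hpoint : ∀ᵐ s ∂(volume.restrict (Ico (0 : ℝ) 1)),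
      ‖v (Γ.γ t s)‖ₑ ^ 2 * ‖deriv (Γ.γ t) s‖ₑ ≤
        ENNReal.ofReal B * (2 * W s + 2 * ∑ K ∈ 𝓣.cells, ENNReal.ofReal (e K ^ 2)) := by
    filter_upwards [hres.ae_mem_interior ht, ae_restrict_mem measurableSet_Ico] with s hs hs1
    obtain ⟨K, hK, hsK⟩ := hs
    rw [mul_comm, ← ofReal_norm (deriv (Γ.γ t) s)]
    refine mul_le_mul' (ENNReal.ofReal_le_ofReal (hB t ht s ⟨hs1.1, hs1.2.le⟩)) ?_
    have h1 := hde K hK _ (interior_subset hsK)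
    rw [← hvw K hK _ hsK, hcons K hK _ (hν s).1 _ ⟨interior_subset hsK, (hν s).2⟩,
      abs_sub_comm] at h1
    have h2 := IFE.ofReal_two_mul_sq_le zero_le_one h1
    rw [one_mul, mul_one, ← IFE.enorm_sq_eq_ofReal, IFE.enorm_sq_eq_ofReal (_ + _),
      ENNReal.ofReal_ofNat] at h2
    refine h2.trans ?_
    gcongr
    -- Replacing one local error by the sum over all elements makes the bound constant along the
    -- curve.
    exact Finset.single_le_sum (f := fun K => ENNReal.ofReal (e K ^ 2)) (fun _ _ => zero_le) hK
  have hfinal : ∫⁻ s in Ico (0 : ℝ) 1, ‖v (Γ.γ t s)‖ₑ ^ 2 * ‖deriv (Γ.γ t) s‖ₑ ≤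
      ENNReal.ofReal C₂ * E := by
    calc _ ≤ ∫⁻ s in Ico (0 : ℝ) 1,
            ENNReal.ofReal B * (2 * W s + 2 * ∑ K ∈ 𝓣.cells, ENNReal.ofReal (e K ^ 2)) :=
          lintegral_mono_ae hpoint
      _ = ENNReal.ofReal B * (2 * (∫⁻ s in Ico (0 : ℝ) 1, W s) +
            2 * ∑ K ∈ 𝓣.cells, ENNReal.ofReal (e K ^ 2)) := by
          rw [lintegral_const_mul' _ _ ENNReal.ofReal_ne_top,
            lintegral_add_right _ measurable_const, lintegral_const_mul' _ _ (by simp),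
            setLIntegral_const]
          simp
      _ ≤ ENNReal.ofReal B * (2 * (ENNReal.ofReal (N / (c * δ)) * (ENNReal.ofReal C₁ * E)) +
            2 * (ENNReal.ofReal (16 * σ ^ 2 * κ ^ 2 / ω) * E)) := by
          gcongr
          exact hWint.trans (by gcongr)
      _ = ENNReal.ofReal C₂ * E := by
          rw [hC₂, ENNReal.ofReal_mul hB0, ENNReal.ofReal_add (by positivity) (by positivity),
            ENNReal.ofReal_mul zero_le_two, ENNReal.ofReal_mul zero_le_two,
            ENNReal.ofReal_mul (by positivity : 0 ≤ N / (c * δ)), ENNReal.ofReal_ofNat]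
          ring
  calc IFE.interfaceL2Norm Γ t v
      ≤ (ENNReal.ofReal (√(C₂ + 1) ^ 2) * E) ^ (1 / 2 : ℝ) := by
        refine ENNReal.rpow_le_rpow (hfinal.trans ?_) (by norm_num)
        rw [Real.sq_sqrt (by positivity)]
        gcongr
        linarith
    _ = ENNReal.ofReal √(C₂ + 1) * IFE.brokenH1Norm 𝓣 v := by
        rw [ENNReal.mul_rpow_of_nonneg _ _ (by norm_num), ENNReal.ofReal_pow (Real.sqrt_nonneg _),
          ← ENNReal.rpow_natCast, ← ENNReal.rpow_mul]
        norm_num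
        rfl
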